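/- The adaptive Fibonacci heap is a heap-ordered forest with a root list (ordered from oldest to newest), a pointer $H.min$ and a size $H.n$; every node has a key, a parent pointer, a list of children, a degree and a mark. MAKE-HEAP, INSERT, FIND-MIN, UNION and DECREASE-KEY (with CUT and CASCADING-CUT) are those of the classical Fibonacci heap of CLRS. EXTRACT-MIN on a non-empty heap takes $z=H.min$, moves the children of $z$ to the end of the root list, and removes $z$; if the root list is now empty it sets $H.min=\mathrm{NIL}$, and otherwise it sets $H.min$ to the right neighbour of $z$ in the circular root list and calls CONSOLIDATE; finally it decrements $H.n$. CONSOLIDATE initializes an array $A[0..D(H.n)]$ with NIL, where $D(n)=\lfloor\log_\varphi n\rfloor$ and $\varphi$ is the golden ratio, calls APPEND$(x,x.degree,A)$ for every root $x$ from oldest to newest, and then builds the new root list from those nodes in $A$ that have no parent, updating $H.min$ whenever it meets a smaller node. APPEND$(x,d,A)$ reads $y=A[d]$ and does the following. - If $y=\mathrm{NIL}$, it only performs the last step below. - If $y<x$, it makes $x$ a child of $y$ provided that $y.degree=d$, and after that, if $y$ has no parent, it calls APPEND$(y,y.degree,A)$. - Otherwise, if $y$ has no parent, it makes $y$ a child of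 $x$. - In all cases the last step is $A[d]=x$. Making a node a child of another one increments the degree of the parent and clears the mark of the child. Nodes are compared by their keys, with ties broken by a fixed order of the nodes. Count one unit of time for each elementary step (access to a field, to the header or to an array cell, a comparison, an insertion into, a deletion from or a concatenation of linked lists), and $k+1$ units for the initialization of an array of length $k$. Let $\Phi(H)=t(H)+2m(H)$, where $t(H)$ is the number of roots and $m(H)$ the number of marked nodes of $H$. **Theorem.** There are absolute constants $c,C>0$ such that the following holds for all linearly ordered sets of keys and for all heaps that arise from empty heaps by the operations above. 1. EXTRACT-MIN on a heap $H$ with $n$ nodes terminates without error (in particular without leaving the bounds of $A$), and its running time $T$ and resulting heap $H'$ satisfy $T+c\,(\Phi(H')-\Phi(H))\le C\max(1,\lg n)$. That is, EXTRACT-MIN runs in $O(\lg n)$ amortized time. 2. INSERT of a new node, FIND-MIN, UNION of two heaps without common nodes, and DECREASE-KEY of a node to a key that is not larger terminate without error and have amortized time $T+c\,\Delta\Phi\le C$, where for UNION the potential before the operation is $\Phi(H_1)+\Phi(H_2)$. 3. Consequently, every sequence of operations that starts from empty heaps takes total time at most $C\sum_i b_i$, where $b_i=\max(1,\lg n_i)$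 if the $i$-th operation is an EXTRACT-MIN on a heap with $n_i$ nodes, and $b_i=1$ otherwise. -/

import Mathlib

namespace AdaptiveFib

noncomputable section

/-- A node of the heap. Nodes are named by natural numbers (their addresses); `children` lists the
children in the order in which they were linked, oldest first. -/
structure Node (K : Type) where
  key : K
  parent : Option ℕ
  children : List ℕ
  degree : ℕ
  mark : Bool

/-- A heap: the nodes it owns (`nodes x = none` when `x` is not a node of the heap), its root list
(a circular doubly linked list, written from the oldest to the newest entry), the pointer to the
minimum, and the number of nodes. -/
structure Heap (K : Type) where
  nodes : ℕ → Option (Node K)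
  roots : List ℕ
  min : Option ℕ
  n : ℕ

/-- The state of a running procedure: the heap, the auxiliary array `A`, and the number of
elementary steps made so far. -/
structure Machine (K : Type) where
  heap : Heap K
  arr : List (Option ℕ)
  time : ℕ

/-- A program. The value `none` means that the program got stuck (it followed a dangling pointer,
left the bounds of the array, or raised an error) or does not terminate. -/
abbrev Prog (K : Type) (α : Type) := StateT (Machine K) Option α

/-- The upper bound `D(n) = ⌊log_φ n⌋` on the degrees, which sizes the array in CONSOLIDATE. -/
def D (n : ℕ) : ℕ := ⌊Real.logb Real.goldenRatio (n : ℝ)⌋₊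

section Primitives

/-! ### Elementary steps: each one takes one unit of time, except the allocation of an array. -/

variable {K : Type}

/-- Count `k` elementary steps. -/
def tick (k : ℕ) : Prog K Unit :=
  fun s => some ((), { s with time := s.time + k })

/-- Read the record of node `x`. -/
def readNode (x : ℕ) : Prog K (Node K) := do
  tick 1
  fun s => (s.heap.nodes x).map fun v => (v, s)

/-- Overwrite the record of node `x`. -/
def writeNode (x : ℕ) (v : Node K) : Prog K Unit := do
  tick 1
  fun s => some ((), { s with heap := { s.heap with
    nodes := Function.update s.heap.nodes x (some v) } })

/-- Node `x` leaves the heap. -/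
def releaseNode (x : ℕ) : Prog K Unit := do
  tick 1
  fun s => some ((), { s with heap := { s.heap with
    nodes := Function.update s.heap.nodes x none } })

/-- Compare two nodes: by their keys, ties being broken by the addresses, so that two different
nodes always compare strictly. -/
def less [LinearOrder K] (x y : ℕ) : Prog K Bool := do
  let v ← readNode x
  let w ← readNode y
  tick 1
  return decide (v.key < w.key ∨ (v.key = w.key ∧ x < y))

def readMin : Prog K (Option ℕ) := do
  tick 1
  fun s => some (s.heap.min, s)

def writeMin (m : Option ℕ) : Prog K Unit := do
  tick 1
  fun s => some ((), { s with heap := { s.heap with min := m } })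

def readSize : Prog K ℕ := do
  tick 1
  fun s => some (s.heap.n, s)

def writeSize (n : ℕ) : Prog K Unit := do
  tick 1
  fun s => some ((), { s with heap := { s.heap with n := n } })

/-- Access to the root list, for an iteration over it (whose steps are counted separately). -/
def rootList : Prog K (List ℕ) := do
  tick 1
  fun s => some (s.heap.roots, s)

/-- Create a new empty root list. -/
def clearRoots : Prog K Unit := do
  tick 1
  fun s => some ((), { s with heap := { s.heap with roots := [] } })

/-- Add `x` to the root list, as its newest entry. -/
def addRoot (x : ℕ) : Prog K Unit := do
  tick 1
  fun s => some ((), { s with heap := { s.heap with roots := s.heap.roots ++ [x] } })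

/-- Unlink `x` from the root list. -/
def removeRoot (x : ℕ) : Prog K Unit := do
  tick 1
  fun s => some ((), { s with heap := { s.heap with roots := s.heap.roots.erase x } })

/-- The successor of `z` in the circular list `l`; it is `z` itself when `l = [z]`. -/
def succIn (l : List ℕ) (z : ℕ) : Option ℕ :=
  ((l.dropWhile (fun w => w != z)).tail ++ l).head?

/-- `z.right` for a member `z` of the root list. -/
def right (z : ℕ) : Prog K (Option ℕ) := do
  tick 1
  fun s => some (succIn s.heap.roots z, s)

/-- A new array with `k` entries, all of them NIL; this takes `k + 1` steps. -/
def newArray (k : ℕ) : Prog K Unit := do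
  tick (k + 1)
  fun s => some ((), { s with arr := List.replicate k none })

/-- Read `A[i]`; stuck when `i` is out of bounds. -/
def readArray (i : ℕ) : Prog K (Option ℕ) := do
  tick 1
  fun s => (s.arr[i]?).map fun a => (a, s)

/-- Write `A[i]`; stuck when `i` is out of bounds. -/
def writeArray (i : ℕ) (a : Option ℕ) : Prog K Unit := do
  tick 1
  fun s => if i < s.arr.length then some ((), { s with arr := s.arr.set i a }) else none

end Primitives

section Procedures

variable {K : Type} [LinearOrder K]

/-- `if x < H.min then H.min = x`, where NIL counts as larger than every node. -/
def updateMin (x : ℕ) : Prog K Unit := do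
  match ← readMin with
  | none => writeMin (some x)
  | some m => if ← less x m then writeMin (some x)

/-- Make `x` a child of `y`, incrementing `y.degree` and clearing the mark of `x`. -/
def link (x y : ℕ) : Prog K Unit := do
  let v ← readNode x
  writeNode x { v with parent := some y, mark := false }
  let w ← readNode y
  writeNode y { w with children := w.children ++ [x], degree := w.degree + 1 }

/-- APPEND. -/
def append (x d : ℕ) : Prog K Unit := do
  match ← readArray d with
  | none => writeArray d (some x)
  | some y =>
    if ← less y x then
      let v ← readNode y
      if v.degree = d then
        link x y
      let w ← readNode y
      if w.parent = none then
        append y w.degree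
      writeArray d (some x)
    else
      let v ← readNode y
      if v.parent = none then
        link y x
      writeArray d (some x)
  partial_fixpoint

/-- CONSOLIDATE. -/
def consolidate : Prog K Unit := do
  let n ← readSize
  newArray (D n + 1)
  let l ← rootList
  l.forM fun x => do
    let v ← readNode x
    append x v.degree
  clearRoots
  (List.range (D n + 1)).forM fun i => do
    match ← readArray i with
    | none => pure ()
    | some x =>
      let v ← readNode x
      if v.parent = none then
        addRoot x
        updateMin x

/-- EXTRACT-MIN; the result is the node with the minimum key, `none` for an empty heap. -/
def extractMin : Prog K (Option ℕ) := do
  match ← readMin with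
  | none => return none
  | some z =>
    let v ← readNode z
    v.children.forM fun x => do
      addRoot x
      let w ← readNode x
      writeNode x { w with parent := none }
    let r ← right z
    removeRoot z
    if r = some z then
      writeMin none
    else
      writeMin r
      consolidate
    let n ← readSize
    writeSize (n - 1)
    releaseNode z
    return some z

/-- INSERT of a new node `x` with key `k`. -/
def insert (x : ℕ) (k : K) : Prog K Unit := do
  writeNode x { key := k, parent := none, children := [], degree := 0, mark := false }
  addRoot x
  updateMin x
  let n ← readSize
  writeSize (n + 1)

/-- FIND-MIN. -/
def findMin : Prog K (Option ℕ) := readMin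

/-- CUT: move `x` from the child list of `y` to the root list. -/
def cut (x y : ℕ) : Prog K Unit := do
  let w ← readNode y
  writeNode y { w with children := w.children.erase x, degree := w.degree - 1 }
  addRoot x
  let v ← readNode x
  writeNode x { v with parent := none, mark := false }

/-- CASCADING-CUT. -/
def cascadingCut (y : ℕ) : Prog K Unit := do
  let v ← readNode y
  match v.parent with
  | none => pure ()
  | some z =>
    if v.mark = false then
      writeNode y { v with mark := true }
    else
      cut y z
      cascadingCut z
  partial_fixpoint

/-- DECREASE-KEY of node `x` to `k`; an error when `k` is greater than the current key. -/
def decreaseKey (x : ℕ) (k : K) : Prog K Unit := do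
  let v ← readNode x
  tick 1
  if v.key < k then
    failure
  else
    writeNode x { v with key := k }
    match v.parent with
    | none => updateMin x
    | some y =>
      if ← less x y then
        cut x y
        cascadingCut y
      updateMin x

/-- UNION of `H₁` and `H₂`, run in a memory that holds the nodes of both. The root lists are
circular doubly linked lists, which are concatenated in one step. -/
def unionProg (H₁ H₂ : Heap K) : Prog K Unit := do
  tick 1
  fun s => some ((), { s with heap := { s.heap with roots := H₁.roots ++ H₂.roots } })
  writeMin H₁.min
  match H₂.min with
  | none => pure ()
  | some m => updateMin m
  writeSize (H₁.n + H₂.n)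

end Procedures

section Runs

variable {K : Type}

/-- The empty heap, made by MAKE-HEAP. -/
def emptyHeap : Heap K := { nodes := fun _ => none, roots := [], min := none, n := 0 }

/-- `Runs p H a H' t`: called on the heap `H`, the program `p` terminates without error after `t`
elementary steps, returns `a` and leaves the heap `H'`. -/
def Runs {α : Type} (p : Prog K α) (H : Heap K) (a : α) (H' : Heap K) (t : ℕ) : Prop :=
  ∃ A : List (Option ℕ), p { heap := H, arr := [], time := 0 } = some (a, ⟨H', A, t⟩)

/-- Two heaps have no common node. -/
def Separate (H₁ H₂ : Heap K) : Prop := ∀ x, H₁.nodes x = none ∨ H₂.nodes x = none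

/-- The memory in which UNION starts: it holds the nodes of both heaps, and a new empty header. -/
def unionStart (H₁ H₂ : Heap K) : Heap K :=
  { (emptyHeap : Heap K) with nodes := fun x => (H₁.nodes x).orElse fun _ => H₂.nodes x }

/-- The potential `Φ(H) = t(H) + 2 m(H)`: the number of roots plus twice the number of marked
nodes. -/
def potential (H : Heap K) : ℕ :=
  H.roots.length + 2 * {x : ℕ | ∃ v, H.nodes x = some v ∧ v.mark = true}.ncard

/-- `lg n`, replaced by `1` for `n < 2`. -/
def lgBound (n : ℕ) : ℝ := max 1 (Real.logb 2 (n : ℝ))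

variable [LinearOrder K]

/-- `History H t b`: the heap `H` is the outcome of some sequence of operations that starts from
MAKE-HEAP calls, the operations take `t` elementary steps altogether, and `b` is the sum of the
claimed amortized bounds: `lg n` for each EXTRACT-MIN on a heap of `n` nodes (but at least `1`), and
`1` for every other operation. -/
inductive History : Heap K → ℕ → ℝ → Prop
  | makeHeap : History emptyHeap 1 1
  | insert {H H' : Heap K} {t τ : ℕ} {b : ℝ} (x : ℕ) (k : K) :
      History H t b → H.nodes x = none → Runs (AdaptiveFib.insert x k) H () H' τ →
      History H' (t + τ) (b + 1)
  | findMin {H H' : Heap K} {t τ : ℕ} {b : ℝ} (m : Option ℕ) :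
      History H t b → Runs AdaptiveFib.findMin H m H' τ → History H' (t + τ) (b + 1)
  | union {H₁ H₂ H' : Heap K} {t₁ t₂ τ : ℕ} {b₁ b₂ : ℝ} :
      History H₁ t₁ b₁ → History H₂ t₂ b₂ → Separate H₁ H₂ →
      Runs (unionProg H₁ H₂) (unionStart H₁ H₂) () H' τ →
      History H' (t₁ + t₂ + τ) (b₁ + b₂ + 1)
  | decreaseKey {H H' : Heap K} {t τ : ℕ} {b : ℝ} (x : ℕ) (k : K) :
      History H t b → Runs (AdaptiveFib.decreaseKey x k) H () H' τ →
      History H' (t + τ) (b + 1)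
  | extractMin {H H' : Heap K} {t τ : ℕ} {b : ℝ} (z : Option ℕ) :
      History H t b → Runs AdaptiveFib.extractMin H z H' τ →
      History H' (t + τ) (b + lgBound H.n)

/-- The heaps that can arise. -/
def Reachable (H : Heap K) : Prop := ∃ t b, History H t b

end Runs

end

end AdaptiveFib

/-! Two things have to be shown: degrees stay logarithmic, and the potential pays for consolidation
and for cascading cuts.

Degrees. In a `Forest` the `i`-th child of a node has degree at least `i`, or `i - 1` if it is
marked. A link preserves this because APPEND only puts a node below one whose degree is not larger
(`Forest.linked`). A cut leaves the parent with one child too few (`Forest.severed`), and this debt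
is absorbed by a fresh mark (`Forest.marked`), passed on by cutting the parent as well, or void at a
root (`Forest.of_root`). The Fibonacci recursion `Forest.fib_le_card_subtree` then bounds all
degrees by `D n` (`Forest.dgOf_le`). The bound holds in every intermediate forest of a
consolidation, so the array is never left.

Consolidation. When `x` of degree `d` absorbs the occupant of cell `d`, it stays in that cell
although its degree is now `d + 1`. `CellsOk` says that no other mismatch arises, and that a
mismatched node is a root; `excess` counts these stale cells. Each recursive call of APPEND comes
after a link, which destroys a root, or moves a stale node to its proper cell. A link that creates a
stale cell also destroys a root and causes no recursion. Hence the number of roots plus the number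
of stale cells is a potential for which APPEND has constant amortized cost (`ends_append`). A
consolidation is therefore linear in the number of roots plus `D n`, and it leaves at most `D n + 1`
roots (`ends_consolidate`), so the potential of the old roots pays for it.

Cascading cuts. Cutting a marked node trades a mark for a root, which lowers the potential by one
unit per cut (`ends_cascadingCut`).

`Ends` expresses total correctness, so termination and absence of errors come from the same
inductions as the time bounds. `History.inv_and_le` telescopes the potential along a sequence of
operations. -/

namespace AdaptiveFib

/-! ### Heap-ordered forests, their order, and the degree bound -/

section Forest

variable {K : Type}

/-- The parent pointer stored at `x`. -/
def parOf (N : ℕ → Option (Node K)) (x : ℕ) : Option ℕ := (N x).bind Node.parent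

/-- The list of children stored at `x`. -/
def chOf (N : ℕ → Option (Node K)) (x : ℕ) : List ℕ := ((N x).map Node.children).getD []

/-- The degree stored at `x`. -/
def dgOf (N : ℕ → Option (Node K)) (x : ℕ) : ℕ := ((N x).map Node.degree).getD 0

/-- The mark stored at `x`. -/
def mkOf (N : ℕ → Option (Node K)) (x : ℕ) : Bool := ((N x).map Node.mark).getD false

/-- The key stored at `x`. -/
def keyOf (N : ℕ → Option (Node K)) (x : ℕ) : Option K := (N x).map Node.key

section Accessors

variable {N N' : ℕ → Option (Node K)} {x : ℕ} {v : Node K}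

theorem parOf_eq (h : N x = some v) : parOf N x = v.parent := by simp [parOf, h]
theorem chOf_eq (h : N x = some v) : chOf N x = v.children := by simp [chOf, h]
theorem dgOf_eq (h : N x = some v) : dgOf N x = v.degree := by simp [dgOf, h]
theorem mkOf_eq (h : N x = some v) : mkOf N x = v.mark := by simp [mkOf, h]
theorem keyOf_eq (h : N x = some v) : keyOf N x = some v.key := by simp [keyOf, h]

theorem parOf_congr (h : N' x = N x) : parOf N' x = parOf N x := by simp [parOf, h]
theorem chOf_congr (h : N' x = N x) : chOf N' x = chOf N x := by simp [chOf, h]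
theorem dgOf_congr (h : N' x = N x) : dgOf N' x = dgOf N x := by simp [dgOf, h]
theorem mkOf_congr (h : N' x = N x) : mkOf N' x = mkOf N x := by simp [mkOf, h]
theorem keyOf_congr (h : N' x = N x) : keyOf N' x = keyOf N x := by simp [keyOf, h]

theorem keyOf_isSome : (keyOf N x).isSome = (N x).isSome := by simp [keyOf]

theorem parOf_update (y : ℕ) : parOf (Function.update N x (some v)) y =
    if y = x then v.parent else parOf N y := by
  by_cases h : y = x <;> simp [parOf, h]

theorem chOf_update (y : ℕ) : chOf (Function.update N x (some v)) y =
    if y = x then v.children else chOf N y := by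
  by_cases h : y = x <;> simp [chOf, h]

theorem dgOf_update (y : ℕ) : dgOf (Function.update N x (some v)) y =
    if y = x then v.degree else dgOf N y := by
  by_cases h : y = x <;> simp [dgOf, h]

theorem mkOf_update (y : ℕ) : mkOf (Function.update N x (some v)) y =
    if y = x then v.mark else mkOf N y := by
  by_cases h : y = x <;> simp [mkOf, h]

theorem keyOf_update (y : ℕ) : keyOf (Function.update N x (some v)) y =
    if y = x then some v.key else keyOf N y := by
  by_cases h : y = x <;> simp [keyOf, h]

end Accessors

/-- `Below N w x`: the chain of parents of `w` leads to `x`. -/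
def Below (N : ℕ → Option (Node K)) : ℕ → ℕ → Prop :=
  Relation.ReflTransGen fun a b => parOf N a = some b

open Classical in
/-- The nodes of the subtree rooted at `x`. -/
noncomputable def subtree (S : Finset ℕ) (N : ℕ → Option (Node K)) (x : ℕ) : Finset ℕ :=
  S.filter fun w => Below N w x

theorem mem_subtree {S : Finset ℕ} {N : ℕ → Option (Node K)} {w x : ℕ} :
    w ∈ subtree S N x ↔ w ∈ S ∧ Below N w x := by
  simp [subtree]

variable [LinearOrder K]

/-- The strict order of the nodes: by keys, ties being broken by addresses. -/
def lt (N : ℕ → Option (Node K)) (x y : ℕ) : Prop :=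
  ∃ k l, keyOf N x = some k ∧ keyOf N y = some l ∧ (k < l ∨ (k = l ∧ x < y))

theorem lt_irrefl (N : ℕ → Option (Node K)) (x : ℕ) : ¬ lt N x x := by
  rintro ⟨k, l, hk, hl, h⟩
  obtain rfl : k = l := by simpa [hk] using hl
  rcases h with h | ⟨-, h⟩ <;> exact absurd h (_root_.lt_irrefl _)

theorem lt_trans {N : ℕ → Option (Node K)} {x y z : ℕ} (h : lt N x y) (h' : lt N y z) :
    lt N x z := by
  obtain ⟨k, l, hk, hl, h⟩ := h
  obtain ⟨l', r, hl', hr, h'⟩ := h'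
  obtain rfl : l = l' := by simpa [hl] using hl'
  refine ⟨k, r, hk, hr, ?_⟩
  rcases h with h | ⟨rfl, h⟩ <;> rcases h' with h' | ⟨rfl, h'⟩
  · exact Or.inl (h.trans h')
  · exact Or.inl h
  · exact Or.inl h'
  · exact Or.inr ⟨rfl, h.trans h'⟩

theorem lt_asymm {N : ℕ → Option (Node K)} {x y : ℕ} (h : lt N x y) : ¬ lt N y x :=
  fun h' => lt_irrefl N x (lt_trans h h')

theorem lt_of_not_lt {N : ℕ → Option (Node K)} {x y : ℕ} (hx : (N x).isSome) (hy : (N y).isSome)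
    (hne : x ≠ y) (h : ¬ lt N x y) : lt N y x := by
  rw [← keyOf_isSome, Option.isSome_iff_exists] at hx hy
  obtain ⟨k, hk⟩ := hx
  obtain ⟨l, hl⟩ := hy
  refine ⟨l, k, hl, hk, ?_⟩
  have h1 : ¬ (k < l ∨ (k = l ∧ x < y)) := fun hh => h ⟨k, l, hk, hl, hh⟩
  rcases lt_trichotomy k l with hkl | hkl | hkl
  · exact absurd (Or.inl hkl) h1
  · refine Or.inr ⟨hkl.symm, ?_⟩
    by_contra hxy
    exact h1 (Or.inr ⟨hkl, by omega⟩)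
  · exact Or.inl hkl

theorem lt_congr {N N' : ℕ → Option (Node K)} {x y : ℕ} (hx : keyOf N' x = keyOf N x)
    (hy : keyOf N' y = keyOf N y) : lt N' x y ↔ lt N x y := by
  simp only [lt, hx, hy]

/-- `m` is the least node of `S`. -/
def LeastOn (N : ℕ → Option (Node K)) (S : Finset ℕ) (m : ℕ) : Prop :=
  m ∈ S ∧ ∀ w ∈ S, w ≠ m → lt N m w

open Classical in
/-- The smaller one of the nodes `m` and `x`, where `none` counts as larger than every node. -/
noncomputable def minOf (N : ℕ → Option (Node K)) (m : Option ℕ) (x : ℕ) : ℕ :=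
  match m with
  | none => x
  | some m => if lt N x m then x else m

theorem minOf_congr {N N' : ℕ → Option (Node K)} {m x : ℕ} (hm : keyOf N' m = keyOf N m)
    (hx : keyOf N' x = keyOf N x) : minOf N' (some m) x = minOf N (some m) x := by
  classical
  exact if_congr (lt_congr hx hm) rfl rfl

theorem LeastOn.singleton (N : ℕ → Option (Node K)) (x : ℕ) : LeastOn N {x} x :=
  ⟨Finset.mem_singleton_self x, fun _ hw hne => absurd (Finset.mem_singleton.1 hw) hne⟩

theorem LeastOn.congr {N N' : ℕ → Option (Node K)} {S : Finset ℕ} {m : ℕ} (h : LeastOn N S m)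
    (hk : ∀ x ∈ S, keyOf N' x = keyOf N x) : LeastOn N' S m :=
  ⟨h.1, fun w hw hne => (lt_congr (hk m h.1) (hk w hw)).2 (h.2 w hw hne)⟩

theorem LeastOn.union {N : ℕ → Option (Node K)} {S T : Finset ℕ} {m x : ℕ} (hm : LeastOn N S m)
    (hx : LeastOn N T x) (hS : (N m).isSome) (hT : (N x).isSome) :
    LeastOn N (S ∪ T) (minOf N (some m) x) := by
  unfold minOf
  dsimp only
  split_ifs with h
  · refine ⟨Finset.mem_union_right _ hx.1, fun w hw hne => ?_⟩
    rcases Finset.mem_union.1 hw with hw | hw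
    · by_cases hwm : w = m
      · exact hwm ▸ h
      · exact lt_trans h (hm.2 w hw hwm)
    · exact hx.2 w hw hne
  · refine ⟨Finset.mem_union_left _ hm.1, fun w hw hne => ?_⟩
    rcases Finset.mem_union.1 hw with hw | hw
    · exact hm.2 w hw hne
    · by_cases hwx : w = x
      · subst hwx
        exact lt_of_not_lt hT hS hne h
      · by_cases hxm : x = m
        · exact hxm ▸ hx.2 w hw hwx
        · exact lt_trans (lt_of_not_lt hT hS hxm h) (hx.2 w hw hwx)

theorem exists_leastOn {N : ℕ → Option (Node K)} {S : Finset ℕ} (hS : S.Nonempty)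
    (hN : ∀ x ∈ S, (N x).isSome) : ∃ m, LeastOn N S m := by
  induction hS using Finset.Nonempty.cons_induction with
  | singleton a => exact ⟨a, LeastOn.singleton N a⟩
  | cons a s ha hs ih =>
    obtain ⟨m, hm⟩ := ih fun x hx => hN x (Finset.mem_cons_of_mem hx)
    refine ⟨minOf N (some a) m, ?_⟩
    rw [Finset.cons_eq_insert, Finset.insert_eq]
    exact (LeastOn.singleton N a).union hm (hN a (Finset.mem_cons_self a s))
      (hN m (Finset.mem_cons_of_mem hm.1))

/-- The nodes in `S` form a heap-ordered forest, in which the `i`-th child of a node (counted from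
`0`) has degree at least `i`, or at least `i - 1` if it is marked. The optional node `e` may have one
child less, and the optional node `o` need not be larger than its parent. -/
structure Forest (S : Finset ℕ) (N : ℕ → Option (Node K)) (e o : Option ℕ) : Prop where
  live : ∀ x ∈ S, (N x).isSome
  deg : ∀ x ∈ S, dgOf N x = (chOf N x).length
  nodup : ∀ x ∈ S, (chOf N x).Nodup
  child : ∀ x ∈ S, ∀ c ∈ chOf N x, c ∈ S ∧ parOf N c = some x
  parent : ∀ c ∈ S, ∀ p, parOf N c = some p → p ∈ S ∧ c ∈ chOf N p
  order : ∀ c ∈ S, ∀ p, parOf N c = some p → o ≠ some c → lt N p c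
  index : ∀ x ∈ S, ∀ i c, (chOf N x)[i]? = some c →
    i ≤ dgOf N c + (mkOf N c).toNat + if e = some c then 1 else 0

theorem Forest.ne_parent {S : Finset ℕ} {N : ℕ → Option (Node K)} {e : Option ℕ}
    (h : Forest S N e none) {x y : ℕ} (hx : x ∈ S) (hp : parOf N x = some y) : x ≠ y := by
  rintro rfl
  exact lt_irrefl N x (h.order x hx x hp (by simp))

/-- A parent would be smaller still. With `exists_leastOn` this provides a root in every nonempty
forest, and it shows that the minimum is found among the roots. -/
theorem Forest.parOf_least {S : Finset ℕ} {N : ℕ → Option (Node K)} {e : Option ℕ}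
    (h : Forest S N e none) {m : ℕ} (hm : LeastOn N S m) : parOf N m = none := by
  by_contra hp
  obtain ⟨p, hp⟩ := Option.ne_none_iff_exists'.1 hp
  exact lt_asymm (h.order m hm.1 p hp (by simp))
    (hm.2 p (h.parent m hm.1 p hp).1 (h.ne_parent hm.1 hp).symm)

/-! ### The size of a subtree -/

section Size

variable {S : Finset ℕ} {N : ℕ → Option (Node K)}

/-- Heap order makes nodes strictly decrease along parent pointers. This is what excludes cycles, so
that acyclicity need not be a separate part of `Forest`. -/
theorem Forest.mem_of_below (h : Forest S N none none) {w x : ℕ} (hw : w ∈ S)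
    (hb : Below N w x) : x ∈ S ∧ (w = x ∨ lt N x w) := by
  induction hb with
  | refl => exact ⟨hw, Or.inl rfl⟩
  | tail hab hbc ih =>
    refine ⟨(h.parent _ ih.1 _ hbc).1, Or.inr ?_⟩
    have h1 := h.order _ ih.1 _ hbc (by simp)
    rcases ih.2 with rfl | h2
    · exact h1
    · exact lt_trans h1 h2

/-- Otherwise the path from `a` to `b` would pass through the common parent `x`, and `x` would lie
below its own child `b`. -/
theorem Forest.not_below_sibling (h : Forest S N none none) {a b x : ℕ} (ha : a ∈ S)
    (hpa : parOf N a = some x) (hpb : parOf N b = some x) (hab : a ≠ b) : ¬ Below N a b := by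
  intro hb
  rcases Relation.ReflTransGen.cases_head hb with rfl | ⟨c, hc, hcb⟩
  · exact hab rfl
  · obtain rfl : x = c := by simpa [hpa] using hc
    have hx := (h.parent a ha x hpa).1
    obtain ⟨hbS, h1⟩ := h.mem_of_below hx hcb
    have h2 := h.order b hbS x hpb (by simp)
    rcases h1 with rfl | h1
    · exact lt_irrefl N _ h2
    · exact lt_asymm h1 h2

/-- Parent pointers form a partial function, so two ancestors of the same node are comparable, and
siblings are not. -/
theorem Forest.disjoint_subtree (h : Forest S N none none) {a b x : ℕ} (ha : a ∈ S) (hb : b ∈ S)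
    (hpa : parOf N a = some x) (hpb : parOf N b = some x) (hab : a ≠ b) :
    Disjoint (subtree S N a) (subtree S N b) := by
  rw [Finset.disjoint_left]
  intro w hwa hwb
  have hu : Relator.RightUnique fun a b => parOf N a = some b := fun a b c hab hac => by
    simpa [hab] using hac
  rcases Relation.ReflTransGen.total_of_right_unique hu (mem_subtree.1 hwa).2
    (mem_subtree.1 hwb).2 with hh | hh
  · exact h.not_below_sibling ha hpa hpb hab hh
  · exact h.not_below_sibling hb hpb hpa hab.symm hh

/-- Child `j` has degree at least `j - 1`, so by induction its subtree contributes at least `Nat.fib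
(j + 1)` nodes; adding the children one at a time reproduces the Fibonacci recurrence. -/
theorem Forest.fib_le_card_subtree (h : Forest S N none none) (k : ℕ) :
    ∀ x ∈ S, k ≤ dgOf N x → Nat.fib (k + 2) ≤ (subtree S N x).card := by
  induction k using Nat.strong_induction_on with
  | _ k ih =>
  intro x hx hk
  set l := chOf N x with hl
  have hlen : k ≤ l.length := h.deg x hx ▸ hk
  have hch : ∀ i (hi : i < l.length), l[i] ∈ S ∧ parOf N l[i] = some x := fun i hi =>
    h.child x hx _ (List.getElem_mem hi)
  -- `T` consists of `x` and the subtrees of its first `j` children; disjointness from the later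
  -- ones lets the next subtree be added.
  suffices H : ∀ j ≤ k, ∃ T : Finset ℕ, T ⊆ subtree S N x ∧ Nat.fib (j + 2) ≤ T.card ∧
      ∀ i (hi : i < l.length), j ≤ i → Disjoint T (subtree S N l[i]) by
    obtain ⟨T, hT, hc, -⟩ := H k le_rfl
    exact hc.trans (Finset.card_le_card hT)
  intro j
  induction j with
  | zero =>
    intro _
    refine ⟨{x}, ?_, by simp, fun i hi _ => ?_⟩
    · rw [Finset.singleton_subset_iff, mem_subtree]
      exact ⟨hx, Relation.ReflTransGen.refl⟩
    · rw [Finset.disjoint_singleton_left, mem_subtree]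
      rintro ⟨-, hb⟩
      have h1 := h.order _ (hch i hi).1 x (hch i hi).2 (by simp)
      rcases (h.mem_of_below hx hb).2 with h2 | h2
      · rw [← h2] at h1
        exact lt_irrefl N _ h1
      · exact lt_asymm h1 h2
  | succ j ihj =>
    intro hj
    obtain ⟨T, hT, hc, hd⟩ := ihj (by omega)
    have hjl : j < l.length := by omega
    refine ⟨T ∪ subtree S N l[j], Finset.union_subset hT ?_, ?_, fun i hi hji => ?_⟩
    · intro w hw
      rw [mem_subtree] at hw ⊢
      exact ⟨hw.1, hw.2.tail (hch j hjl).2⟩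
    · rw [Finset.card_union_of_disjoint (hd j hjl le_rfl)]
      have hi := h.index x hx j l[j] (by rw [← hl]; exact List.getElem?_eq_getElem hjl)
      have hm : (mkOf N l[j]).toNat ≤ 1 := Bool.toNat_le _
      simp only [reduceCtorEq, if_false, add_zero] at hi
      have h1 : Nat.fib (j - 1 + 2) ≤ (subtree S N l[j]).card :=
        ih (j - 1) (by omega) _ (hch j hjl).1 (by omega)
      -- The subtraction truncates for `j = 0`, where the bound is the harmless `fib 1 ≤ fib 2`.
      have h2 : Nat.fib (j + 1) ≤ Nat.fib (j - 1 + 2) := Nat.fib_mono (by omega)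
      have h3 : Nat.fib (j + 1 + 2) = Nat.fib (j + 1) + Nat.fib (j + 1 + 1) := Nat.fib_add_two
      rw [h3]
      have h4 : Nat.fib (j + 1 + 1) ≤ T.card := hc
      omega
    · rw [Finset.disjoint_union_left]
      refine ⟨hd i hi (by omega), h.disjoint_subtree (hch j hjl).1 (hch i hi).1 (hch j hjl).2
        (hch i hi).2 fun he => ?_⟩
      have := (List.Nodup.getElem_inj_iff (h.nodup x hx)).1 he
      omega

theorem goldenRatio_pow_le_fib (k : ℕ) : Real.goldenRatio ^ k ≤ (Nat.fib (k + 2) : ℝ) := by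
  induction k using Nat.twoStepInduction with
  | zero => simp
  | one => simpa [Nat.fib] using Real.goldenRatio_lt_two.le
  | more k h1 h2 =>
    have h3 : Nat.fib (k + 2 + 2) = Nat.fib (k + 2) + Nat.fib (k + 1 + 2) := Nat.fib_add_two
    rw [h3, pow_add, Real.goldenRatio_sq]
    push_cast
    rw [pow_succ] at h2
    linarith

/-- An inequality for the size is needed because CONSOLIDATE runs when the old minimum has left the
forest but `H.n` has not been decremented yet. -/
theorem Forest.dgOf_le (h : Forest S N none none) {n : ℕ} (hn : S.card ≤ n) {x : ℕ} (hx : x ∈ S) :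
    dgOf N x ≤ D n := by
  have h1 := h.fib_le_card_subtree _ x hx le_rfl
  have h2 : (subtree S N x).card ≤ n :=
    (Finset.card_le_card fun w hw => (mem_subtree.1 hw).1).trans hn
  have h3 : Real.goldenRatio ^ dgOf N x ≤ (n : ℝ) :=
    (goldenRatio_pow_le_fib _).trans (by exact_mod_cast h1.trans h2)
  have h4 : (0 : ℝ) < n := lt_of_lt_of_le (pow_pos Real.goldenRatio_pos _) h3
  refine Nat.le_floor ?_
  rw [Real.le_logb_iff_rpow_le Real.one_lt_goldenRatio h4, Real.rpow_natCast]
  exact h3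

end Size

end Forest

/-- The golden ratio satisfies `φ² = φ + 1 ≥ 2`, so passing from base `φ` to base `2` costs at most
a factor of two. -/
theorem D_le (n : ℕ) : (D n : ℝ) ≤ 2 * lgBound n := by
  rcases Nat.eq_zero_or_pos n with rfl | hn
  · simp [D, lgBound]
  have hn1 : (1 : ℝ) ≤ n := by exact_mod_cast hn
  have hφ := Real.one_lt_goldenRatio
  have hnn : 0 ≤ Real.logb Real.goldenRatio n := Real.logb_nonneg hφ hn1
  refine (Nat.floor_le hnn).trans (le_trans ?_
    (mul_le_mul_of_nonneg_left (le_max_right _ _) zero_le_two))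
  have h2 : Real.log 2 ≤ 2 * Real.log Real.goldenRatio := by
    rw [← Real.log_rpow Real.goldenRatio_pos]
    refine Real.log_le_log two_pos ?_
    rw [Real.rpow_two, Real.goldenRatio_sq]
    linarith
  have hlφ := Real.log_pos hφ
  have hl2 := Real.log_pos one_lt_two
  have hln := Real.log_nonneg hn1
  rw [Real.logb, Real.logb, ← mul_div_assoc, div_le_div_iff₀ hlφ hl2]
  nlinarith

/-! ### Total correctness of programs, one rule for each elementary step -/

section Ends

variable {K α β : Type}

/-- Run from the state `s`, the program `p` terminates without error, and its result and final state
satisfy `Q`. -/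
def Ends (p : Prog K α) (s : Machine K) (Q : α → Machine K → Prop) : Prop :=
  ∃ a s', p s = some (a, s') ∧ Q a s'

theorem Ends.mono {p : Prog K α} {s : Machine K} {Q Q' : α → Machine K → Prop} (h : Ends p s Q)
    (hQ : ∀ a s', Q a s' → Q' a s') : Ends p s Q' := by
  obtain ⟨a, s', hp, hq⟩ := h
  exact ⟨a, s', hp, hQ a s' hq⟩

-- Programs are deterministic, so the sequencing rule is an equivalence and a program can be
-- executed symbolically by rewriting.
@[simp]
theorem ends_bind {p : Prog K α} {f : α → Prog K β} {s : Machine K} {Q : β → Machine K → Prop} :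
    Ends (p >>= f) s Q ↔ Ends p s fun a s' => Ends (f a) s' Q := by
  change (∃ b s', ((p s).bind fun r => f r.1 r.2) = some (b, s') ∧ Q b s') ↔ _
  cases h : p s with
  | none => simp [Ends, h]
  | some r =>
    obtain ⟨a, s'⟩ := r
    simp [Ends, h]

theorem ends_iff {p : Prog K α} {s s' : Machine K} {a : α} {Q : α → Machine K → Prop}
    (h : p s = some (a, s')) : Ends p s Q ↔ Q a s' := by
  simp only [Ends, h, Option.some.injEq, Prod.mk.injEq]
  constructor
  · rintro ⟨_, _, ⟨rfl, rfl⟩, hq⟩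
    exact hq
  · exact fun hq => ⟨a, s', ⟨rfl, rfl⟩, hq⟩

@[simp]
theorem ends_pure {a : α} {s : Machine K} {Q : α → Machine K → Prop} :
    Ends (pure a) s Q ↔ Q a s :=
  ends_iff rfl

variable {N : ℕ → Option (Node K)} {R : List ℕ} {m : Option ℕ} {n t : ℕ} {A : List (Option ℕ)}

@[simp]
theorem ends_tick {k : ℕ} {Q : Unit → Machine K → Prop} :
    Ends (tick k) ⟨⟨N, R, m, n⟩, A, t⟩ Q ↔ Q () ⟨⟨N, R, m, n⟩, A, t + k⟩ :=
  ends_iff rfl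

theorem ends_readNode {x : ℕ} {v : Node K} {Q : Node K → Machine K → Prop} (hx : N x = some v) :
    Ends (readNode x) ⟨⟨N, R, m, n⟩, A, t⟩ Q ↔ Q v ⟨⟨N, R, m, n⟩, A, t + 1⟩ := by
  simp only [readNode, ends_bind, ends_tick]
  exact ends_iff (by simp [hx])

@[simp]
theorem ends_writeNode {x : ℕ} {v : Node K} {Q : Unit → Machine K → Prop} :
    Ends (writeNode x v) ⟨⟨N, R, m, n⟩, A, t⟩ Q ↔
      Q () ⟨⟨Function.update N x (some v), R, m, n⟩, A, t + 1⟩ :=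
  ends_iff rfl

@[simp]
theorem ends_releaseNode {x : ℕ} {Q : Unit → Machine K → Prop} :
    Ends (releaseNode x) ⟨⟨N, R, m, n⟩, A, t⟩ Q ↔
      Q () ⟨⟨Function.update N x none, R, m, n⟩, A, t + 1⟩ :=
  ends_iff rfl

@[simp]
theorem ends_readMin {Q : Option ℕ → Machine K → Prop} :
    Ends readMin ⟨⟨N, R, m, n⟩, A, t⟩ Q ↔ Q m ⟨⟨N, R, m, n⟩, A, t + 1⟩ :=
  ends_iff rfl

@[simp]
theorem ends_writeMin {m' : Option ℕ} {Q : Unit → Machine K → Prop} :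
    Ends (writeMin m') ⟨⟨N, R, m, n⟩, A, t⟩ Q ↔ Q () ⟨⟨N, R, m', n⟩, A, t + 1⟩ :=
  ends_iff rfl

@[simp]
theorem ends_readSize {Q : ℕ → Machine K → Prop} :
    Ends readSize ⟨⟨N, R, m, n⟩, A, t⟩ Q ↔ Q n ⟨⟨N, R, m, n⟩, A, t + 1⟩ :=
  ends_iff rfl

@[simp]
theorem ends_writeSize {n' : ℕ} {Q : Unit → Machine K → Prop} :
    Ends (writeSize n') ⟨⟨N, R, m, n⟩, A, t⟩ Q ↔ Q () ⟨⟨N, R, m, n'⟩, A, t + 1⟩ :=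
  ends_iff rfl

@[simp]
theorem ends_rootList {Q : List ℕ → Machine K → Prop} :
    Ends rootList ⟨⟨N, R, m, n⟩, A, t⟩ Q ↔ Q R ⟨⟨N, R, m, n⟩, A, t + 1⟩ :=
  ends_iff rfl

@[simp]
theorem ends_clearRoots {Q : Unit → Machine K → Prop} :
    Ends clearRoots ⟨⟨N, R, m, n⟩, A, t⟩ Q ↔ Q () ⟨⟨N, [], m, n⟩, A, t + 1⟩ :=
  ends_iff rfl

@[simp]
theorem ends_addRoot {x : ℕ} {Q : Unit → Machine K → Prop} :
    Ends (addRoot x) ⟨⟨N, R, m, n⟩, A, t⟩ Q ↔ Q () ⟨⟨N, R ++ [x], m, n⟩, A, t + 1⟩ :=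
  ends_iff rfl

@[simp]
theorem ends_removeRoot {x : ℕ} {Q : Unit → Machine K → Prop} :
    Ends (removeRoot x) ⟨⟨N, R, m, n⟩, A, t⟩ Q ↔ Q () ⟨⟨N, R.erase x, m, n⟩, A, t + 1⟩ :=
  ends_iff rfl

@[simp]
theorem ends_right {z : ℕ} {Q : Option ℕ → Machine K → Prop} :
    Ends (right z) ⟨⟨N, R, m, n⟩, A, t⟩ Q ↔ Q (succIn R z) ⟨⟨N, R, m, n⟩, A, t + 1⟩ :=
  ends_iff rfl

@[simp]
theorem ends_newArray {k : ℕ} {Q : Unit → Machine K → Prop} :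
    Ends (newArray k) ⟨⟨N, R, m, n⟩, A, t⟩ Q ↔
      Q () ⟨⟨N, R, m, n⟩, List.replicate k none, t + (k + 1)⟩ :=
  ends_iff rfl

theorem ends_readArray {i : ℕ} {a : Option ℕ} {Q : Option ℕ → Machine K → Prop}
    (hi : A[i]? = some a) :
    Ends (readArray i) ⟨⟨N, R, m, n⟩, A, t⟩ Q ↔ Q a ⟨⟨N, R, m, n⟩, A, t + 1⟩ := by
  simp only [readArray, ends_bind, ends_tick]
  exact ends_iff (by simp [hi])

theorem ends_writeArray {i : ℕ} {a : Option ℕ} {Q : Unit → Machine K → Prop} (hi : i < A.length) :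
    Ends (writeArray i a) ⟨⟨N, R, m, n⟩, A, t⟩ Q ↔ Q () ⟨⟨N, R, m, n⟩, A.set i a, t + 1⟩ := by
  simp only [writeArray, ends_bind, ends_tick]
  exact ends_iff (by simp [hi])

theorem ends_less [LinearOrder K] {x y : ℕ} {Q : Bool → Machine K → Prop} (hx : (N x).isSome)
    (hy : (N y).isSome) : Ends (less x y) ⟨⟨N, R, m, n⟩, A, t⟩ Q ↔
      ∃ b : Bool, (b = true ↔ lt N x y) ∧ Q b ⟨⟨N, R, m, n⟩, A, t + 3⟩ := by
  obtain ⟨v, hv⟩ := Option.isSome_iff_exists.1 hx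
  obtain ⟨w, hw⟩ := Option.isSome_iff_exists.1 hy
  simp only [less, ends_bind, ends_readNode hv, ends_readNode hw, ends_tick, ends_pure]
  have : lt N x y ↔ (v.key < w.key ∨ (v.key = w.key ∧ x < y)) := by
    simp [lt, keyOf_eq hv, keyOf_eq hw]
  by_cases h : v.key < w.key ∨ (v.key = w.key ∧ x < y) <;> simp [this, h]

theorem ends_less_of_lt [LinearOrder K] {x y : ℕ} {Q : Bool → Machine K → Prop}
    (hx : (N x).isSome) (hy : (N y).isSome) (h : lt N x y) :
    Ends (less x y) ⟨⟨N, R, m, n⟩, A, t⟩ Q ↔ Q true ⟨⟨N, R, m, n⟩, A, t + 3⟩ := by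
  simp [ends_less hx hy, h]

theorem ends_less_of_not_lt [LinearOrder K] {x y : ℕ} {Q : Bool → Machine K → Prop}
    (hx : (N x).isSome) (hy : (N y).isSome) (h : ¬ lt N x y) :
    Ends (less x y) ⟨⟨N, R, m, n⟩, A, t⟩ Q ↔ Q false ⟨⟨N, R, m, n⟩, A, t + 3⟩ := by
  simp [ends_less hx hy, h]

/-- The `5` is one read, three steps for the comparison, and one write. The time is only bounded
from above, which lets all branches share one postcondition. -/
theorem ends_updateMin [LinearOrder K] {x : ℕ} {Q : Unit → Machine K → Prop} (hx : (N x).isSome)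
    (hm : ∀ a, m = some a → (N a).isSome)
    (hQ : ∀ t' ≤ t + 5, Q () ⟨⟨N, R, some (minOf N m x), n⟩, A, t'⟩) :
    Ends (updateMin x) ⟨⟨N, R, m, n⟩, A, t⟩ Q := by
  cases m with
  | none =>
    simp only [updateMin, ends_bind, ends_readMin, ends_writeMin]
    exact hQ _ (by omega)
  | some a =>
    simp only [updateMin, ends_bind, ends_readMin]
    by_cases h : lt N x a
    · rw [ends_less_of_lt hx (hm a rfl) h, if_pos rfl, ends_writeMin]
      simpa [minOf, h] using hQ (t + 1 + 3 + 1) (by omega)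
    · rw [ends_less_of_not_lt hx (hm a rfl) h, if_neg (by simp), ends_pure]
      simpa [minOf, h] using hQ (t + 1 + 3) (by omega)

/-- The records after making `x` a child of `y`. -/
def linked (N : ℕ → Option (Node K)) (x y : ℕ) (a : ℕ) : Option (Node K) :=
  if a = y then (N y).map fun w => { w with children := w.children ++ [x], degree := w.degree + 1 }
  else if a = x then (N x).map fun v => { v with parent := some y, mark := false }
  else N a

theorem ends_link {x y : ℕ} {Q : Unit → Machine K → Prop} (hx : (N x).isSome)
    (hy : (N y).isSome) (hne : x ≠ y) :
    Ends (link x y) ⟨⟨N, R, m, n⟩, A, t⟩ Q ↔ Q () ⟨⟨linked N x y, R, m, n⟩, A, t + 4⟩ := by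
  obtain ⟨v, hv⟩ := Option.isSome_iff_exists.1 hx
  obtain ⟨w, hw⟩ := Option.isSome_iff_exists.1 hy
  have h1 : Function.update N x (some { v with parent := some y, mark := false }) y = some w := by
    rw [Function.update_of_ne hne.symm, hw]
  simp only [link, ends_bind, ends_readNode hv, ends_writeNode, ends_readNode h1]
  have : linked N x y = Function.update
      (Function.update N x (some { v with parent := some y, mark := false })) y
      (some { w with children := w.children ++ [x], degree := w.degree + 1 }) := by
    funext a
    simp [linked, Function.update_apply, hv, hw]
  rw [this]

/-- The records after cutting `x` from its parent `y`. -/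
def severed (N : ℕ → Option (Node K)) (x y : ℕ) (a : ℕ) : Option (Node K) :=
  if a = x then (N x).map fun v => { v with parent := none, mark := false }
  else if a = y then (N y).map fun w =>
    { w with children := w.children.erase x, degree := w.degree - 1 }
  else N a

theorem ends_cut {x y : ℕ} {Q : Unit → Machine K → Prop} (hx : (N x).isSome)
    (hy : (N y).isSome) (hne : x ≠ y) :
    Ends (cut x y) ⟨⟨N, R, m, n⟩, A, t⟩ Q ↔
      Q () ⟨⟨severed N x y, R ++ [x], m, n⟩, A, t + 5⟩ := by
  obtain ⟨v, hv⟩ := Option.isSome_iff_exists.1 hx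
  obtain ⟨w, hw⟩ := Option.isSome_iff_exists.1 hy
  have h1 : Function.update N y (some { w with
      children := w.children.erase x, degree := w.degree - 1 }) x = some v := by
    rw [Function.update_of_ne hne, hv]
  simp only [cut, ends_bind, ends_readNode hw, ends_writeNode, ends_addRoot, ends_readNode h1]
  have : severed N x y = Function.update (Function.update N y (some { w with
      children := w.children.erase x, degree := w.degree - 1 })) x
      (some { v with parent := none, mark := false }) := by
    funext a
    simp [severed, Function.update_apply, hv, hw]
  rw [this]

end Ends

/-! ### The effect of links, cuts and marks on the forest -/

section Changes

variable {K : Type} {N : ℕ → Option (Node K)} {x y : ℕ}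

theorem linked_isSome (a : ℕ) : (linked N x y a).isSome = (N a).isSome := by
  unfold linked; split_ifs <;> simp_all

theorem keyOf_linked (a : ℕ) : keyOf (linked N x y) a = keyOf N a := by
  unfold keyOf linked; split_ifs <;> simp_all [Function.comp_def]

theorem parOf_linked (hx : (N x).isSome) (hne : x ≠ y) (a : ℕ) :
    parOf (linked N x y) a = if a = x then some y else parOf N a := by
  obtain ⟨v, hv⟩ := Option.isSome_iff_exists.1 hx
  by_cases hax : a = x
  · simp [parOf, linked, hax, hne, hv]
  · by_cases hay : a = y
    · subst hay; cases h : N a <;> simp [parOf, linked, hax, h]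
    · simp [parOf, linked, hax, hay]

theorem chOf_linked (hy : (N y).isSome) (a : ℕ) :
    chOf (linked N x y) a = if a = y then chOf N y ++ [x] else chOf N a := by
  obtain ⟨w, hw⟩ := Option.isSome_iff_exists.1 hy
  by_cases hay : a = y
  · simp [chOf, linked, hay, hw]
  · by_cases hax : a = x
    · subst hax; cases h : N a <;> simp [chOf, linked, hay, h]
    · simp [chOf, linked, hax, hay]

theorem dgOf_linked (hy : (N y).isSome) (a : ℕ) :
    dgOf (linked N x y) a = if a = y then dgOf N y + 1 else dgOf N a := by
  obtain ⟨w, hw⟩ := Option.isSome_iff_exists.1 hy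
  by_cases hay : a = y
  · simp [dgOf, linked, hay, hw]
  · by_cases hax : a = x
    · subst hax; cases h : N a <;> simp [dgOf, linked, hay, h]
    · simp [dgOf, linked, hax, hay]

theorem mkOf_linked (hne : x ≠ y) (a : ℕ) :
    mkOf (linked N x y) a = if a = x then false else mkOf N a := by
  by_cases hax : a = x
  · subst hax; cases h : N a <;> simp [mkOf, linked, hne, h]
  · by_cases hay : a = y
    · subst hay; cases h : N a <;> simp [mkOf, linked, hax, h]
    · simp [mkOf, linked, hax, hay]

theorem linked_of_ne {a : ℕ} (hx : a ≠ x) (hy : a ≠ y) : linked N x y a = N a := by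
  simp [linked, hx, hy]

theorem severed_isSome (a : ℕ) : (severed N x y a).isSome = (N a).isSome := by
  unfold severed; split_ifs <;> simp_all

theorem keyOf_severed (a : ℕ) : keyOf (severed N x y) a = keyOf N a := by
  unfold keyOf severed; split_ifs <;> simp_all [Function.comp_def]

theorem parOf_severed (a : ℕ) :
    parOf (severed N x y) a = if a = x then none else parOf N a := by
  by_cases hax : a = x
  · subst hax; cases h : N a <;> simp [parOf, severed, h]
  · by_cases hay : a = y
    · subst hay; cases h : N a <;> simp [parOf, severed, hax, h]
    · simp [parOf, severed, hax, hay]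

theorem chOf_severed (hne : x ≠ y) (a : ℕ) :
    chOf (severed N x y) a = if a = y then (chOf N y).erase x else chOf N a := by
  by_cases hay : a = y
  · subst hay; cases h : N a <;> simp [chOf, severed, hne.symm, h]
  · by_cases hax : a = x
    · subst hax; cases h : N a <;> simp [chOf, severed, hay, h]
    · simp [chOf, severed, hax, hay]

theorem dgOf_severed (hne : x ≠ y) (a : ℕ) :
    dgOf (severed N x y) a = if a = y then dgOf N y - 1 else dgOf N a := by
  by_cases hay : a = y
  · subst hay; cases h : N a <;> simp [dgOf, severed, hne.symm, h]
  · by_cases hax : a = x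
    · subst hax; cases h : N a <;> simp [dgOf, severed, hay, h]
    · simp [dgOf, severed, hax, hay]

theorem mkOf_severed (a : ℕ) :
    mkOf (severed N x y) a = if a = x then false else mkOf N a := by
  by_cases hax : a = x
  · subst hax; cases h : N a <;> simp [mkOf, severed, h]
  · by_cases hay : a = y
    · subst hay; cases h : N a <;> simp [mkOf, severed, hax, h]
    · simp [mkOf, severed, hax, hay]

variable [LinearOrder K] {S : Finset ℕ}

/-- Linking a root below a smaller node whose degree is not larger. -/
theorem Forest.linked (h : Forest S N none none) (hx : x ∈ S) (hy : y ∈ S)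
    (hp : parOf N x = none) (hlt : lt N y x) (hd : dgOf N y ≤ dgOf N x) :
    Forest S (linked N x y) none none := by
  have hne : x ≠ y := by rintro rfl; exact lt_irrefl N x hlt
  have hxl := h.live x hx
  have hyl := h.live y hy
  have hxy : ∀ z ∈ S, x ∉ chOf N z := fun z hz hc => by simpa [hp] using (h.child z hz x hc).2
  refine ⟨fun a ha => ?_, fun a ha => ?_, fun a ha => ?_, fun a ha c hc => ?_, fun c hc p hcp => ?_,
    fun c hc p hcp _ => ?_, fun a ha i c hi => ?_⟩
  · rw [linked_isSome]; exact h.live a ha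
  · rw [dgOf_linked hyl, chOf_linked hyl]
    split_ifs with hay
    · rw [h.deg y hy, List.length_append, List.length_singleton]
    · exact h.deg a ha
  · rw [chOf_linked hyl]
    split_ifs with hay
    · exact List.nodup_append.2 ⟨h.nodup y hy, List.nodup_singleton x, fun u hu w hw => by
        rintro rfl; exact hxy y hy (List.mem_singleton.1 hw ▸ hu)⟩
    · exact h.nodup a ha
  · rw [chOf_linked hyl] at hc
    rw [parOf_linked hxl hne]
    split_ifs at hc with hay
    · rcases List.mem_append.1 hc with hc' | hc
      · have hcx : c ≠ x := by rintro rfl; exact hxy y hy hc'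
        simpa [hcx, hay] using h.child y hy c hc'
      · simp [List.mem_singleton.1 hc, hx, hay]
    · have hcx : c ≠ x := by rintro rfl; exact hxy a ha hc
      simpa [hcx] using h.child a ha c hc
  · rw [parOf_linked hxl hne] at hcp
    rw [chOf_linked hyl]
    split_ifs at hcp with hcx
    · obtain rfl : y = p := by simpa using hcp
      simp [hy, hcx]
    · obtain ⟨h1, h2⟩ := h.parent c hc p hcp
      refine ⟨h1, ?_⟩
      split_ifs with hpy
      · exact List.mem_append_left _ (hpy ▸ h2)
      · exact h2
  · rw [lt_congr (keyOf_linked _) (keyOf_linked _)]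
    rw [parOf_linked hxl hne] at hcp
    split_ifs at hcp with hcx
    · obtain rfl : y = p := by simpa using hcp
      exact hcx ▸ hlt
    · exact h.order c hc p hcp (by simp)
  · rw [dgOf_linked hyl, mkOf_linked hne]
    rw [chOf_linked hyl] at hi
    simp only [reduceCtorEq, if_false, add_zero]
    have hold : ∀ b ∈ S, (chOf N b)[i]? = some c →
        i ≤ (if c = y then dgOf N y + 1 else dgOf N c) +
          (if c = x then false else mkOf N c).toNat := fun b hb hj => by
      have hcx : c ≠ x := by rintro rfl; exact hxy b hb (List.mem_of_getElem? hj)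
      have := h.index b hb i c hj
      simp only [reduceCtorEq, if_false, add_zero] at this
      rw [if_neg hcx]
      split_ifs with hcy
      · subst hcy; omega
      · exact this
    split_ifs at hi with hay
    · rw [List.getElem?_append] at hi
      split_ifs at hi with hil
      · exact hold y hy hi
      · obtain ⟨h1, h2⟩ := List.getElem?_eq_some_iff.1 hi
        have hcx : c = x := by simpa using h2.symm
        -- The new child `x` is last, so its index is the former degree of `y`, which by hypothesis
        -- is at most the degree of `x`.
        have : i = dgOf N y := by
          rw [h.deg y hy]; simp only [List.length_singleton] at h1; omega
        subst hcx
        rw [if_neg hne]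
        omega
    · exact hold a ha hi

/-- Removing a child moves the others only towards the front, so lower bounds on degrees by position
survive a cut. -/
theorem getElem?_of_sublist {β : Type*} {l l' : List β} (h : l'.Sublist l) :
    ∀ {i : ℕ} {c : β}, l'[i]? = some c → ∃ j, i ≤ j ∧ l[j]? = some c := by
  induction h with
  | slnil => intro i c hi; simp at hi
  | cons a _ ih =>
    intro i c hi
    obtain ⟨j, hj, h⟩ := ih hi
    exact ⟨j + 1, by omega, by simpa using h⟩
  | cons_cons a _ ih =>
    intro i c hi
    cases i with
    | zero => exact ⟨0, le_rfl, by simpa using hi⟩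
    | succ i =>
      obtain ⟨j, hj, h⟩ := ih (by simpa using hi)
      exact ⟨j + 1, by omega, by simpa using h⟩

/-- Cutting `x` from its parent `y`. -/
theorem Forest.severed {e o : Option ℕ} (h : Forest S N e o) (hx : x ∈ S)
    (hp : parOf N x = some y) (hne : x ≠ y) (he : ∀ a, e = some a → a = x)
    (ho : ∀ a, o = some a → a = x) : Forest S (severed N x y) (some y) none := by
  obtain ⟨hy, hxy⟩ := h.parent x hx y hp
  have hxc : ∀ z ∈ S, z ≠ y → x ∉ chOf N z := fun z hz hzy hc => hzy <| by
    simpa [hp, eq_comm] using (h.child z hz x hc).2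
  refine ⟨fun a ha => ?_, fun a ha => ?_, fun a ha => ?_, fun a ha c hc => ?_, fun c hc p hcp => ?_,
    fun c hc p hcp _ => ?_, fun a ha i c hi => ?_⟩
  · rw [severed_isSome]; exact h.live a ha
  · rw [dgOf_severed hne, chOf_severed hne]
    split_ifs with hay
    · rw [h.deg y hy, List.length_erase_of_mem hxy]
    · exact h.deg a ha
  · rw [chOf_severed hne]
    split_ifs with hay
    · exact (h.nodup y hy).erase x
    · exact h.nodup a ha
  · rw [chOf_severed hne] at hc
    rw [parOf_severed]
    split_ifs at hc with hay
    · obtain ⟨hcx, hc⟩ := ((h.nodup y hy).mem_erase_iff).1 hc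
      simpa [hcx, hay] using h.child y hy c hc
    · have hcx : c ≠ x := by rintro rfl; exact hxc a ha hay hc
      simpa [hcx] using h.child a ha c hc
  · rw [parOf_severed] at hcp
    rw [chOf_severed hne]
    split_ifs at hcp with hcx
    obtain ⟨h1, h2⟩ := h.parent c hc p hcp
    refine ⟨h1, ?_⟩
    split_ifs with hpy
    · exact ((h.nodup y hy).mem_erase_iff).2 ⟨hcx, hpy ▸ h2⟩
    · exact h2
  · rw [lt_congr (keyOf_severed _) (keyOf_severed _)]
    rw [parOf_severed] at hcp
    split_ifs at hcp with hcx
    exact h.order c hc p hcp fun hoc => hcx (ho c hoc)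
  · rw [dgOf_severed hne, mkOf_severed]
    rw [chOf_severed hne] at hi
    -- Here `j` is the position before the cut. If `c` is `y` itself, its degree has dropped by one,
    -- and the new slack makes up for it.
    have hold : ∀ b ∈ S, c ≠ x → ∀ j, i ≤ j → (chOf N b)[j]? = some c →
        i ≤ (if c = y then dgOf N y - 1 else dgOf N c) +
          (if c = x then false else mkOf N c).toNat + if some y = some c then 1 else 0 :=
      fun b hb hcx j hij hj => by
        have h1 := h.index b hb j c hj
        rw [if_neg fun hec => hcx (he c hec)] at h1
        rw [if_neg hcx]
        by_cases hcy : c = y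
        · subst hcy
          simp only [if_true]
          omega
        · rw [if_neg hcy]
          omega
    split_ifs at hi with hay
    · obtain ⟨j, hij, hj⟩ := getElem?_of_sublist List.erase_sublist hi
      exact hold y hy ((h.nodup y hy).mem_erase_iff.1 (List.mem_of_getElem? hi)).1 j hij hj
    · refine hold a ha ?_ i le_rfl hi
      rintro rfl
      exact hxc a ha hay (List.mem_of_getElem? hi)

/-- A root needs no slack. -/
theorem Forest.of_root {e : Option ℕ} (h : Forest S N e none)
    (he : ∀ a, e = some a → parOf N a = none) : Forest S N none none := by
  refine ⟨h.live, h.deg, h.nodup, h.child, h.parent, h.order, fun x hx i c hi => ?_⟩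
  have h1 := h.index x hx i c hi
  have h2 := (h.child x hx c (List.mem_of_getElem? hi)).2
  rw [if_neg fun hec => by simp [he c hec] at h2] at h1
  simpa using h1

/-- Marking an unmarked node that has lost a child. -/
theorem Forest.marked (h : Forest S N (some y) none) {v : Node K} (hv : N y = some v)
    (hm : v.mark = false) :
    Forest S (Function.update N y (some { v with mark := true })) none none := by
  set N' := Function.update N y (some { v with mark := true }) with hN'
  have hpar : parOf N' = parOf N := by
    funext a; rw [hN', parOf_update]; split_ifs with hay
    · rw [hay, parOf_eq hv]
    · rfl
  have hch : chOf N' = chOf N := by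
    funext a; rw [hN', chOf_update]; split_ifs with hay
    · rw [hay, chOf_eq hv]
    · rfl
  have hdg : dgOf N' = dgOf N := by
    funext a; rw [hN', dgOf_update]; split_ifs with hay
    · rw [hay, dgOf_eq hv]
    · rfl
  have hkey : keyOf N' = keyOf N := by
    funext a; rw [hN', keyOf_update]; split_ifs with hay
    · rw [hay, keyOf_eq hv]
    · rfl
  refine ⟨fun a ha => ?_, hch ▸ hdg ▸ h.deg, hch ▸ h.nodup, hch ▸ hpar ▸ h.child,
    hch ▸ hpar ▸ h.parent, fun c hc p hcp ho => ?_, fun x hx i c hi => ?_⟩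
  · rw [← keyOf_isSome, hkey, keyOf_isSome]; exact h.live a ha
  · exact (lt_congr (congrFun hkey _) (congrFun hkey _)).2 (h.order c hc p (hpar ▸ hcp) ho)
  · rw [hch] at hi
    have h1 := h.index x hx i c hi
    rw [hdg, hN', mkOf_update]
    by_cases hcy : c = y
    · subst hcy
      rw [mkOf_eq hv, hm] at h1
      simpa using h1
    · rw [if_neg fun hh => hcy (by simpa using hh.symm)] at h1
      simpa [hcy] using h1

end Changes

/-! ### The array of CONSOLIDATE and the amortized cost of APPEND -/

section Cells

variable {K : Type}

/-- The nodes in the cells of an array. -/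
def items (cs : List (Option ℕ)) : List ℕ := cs.reduceOption

@[simp] theorem items_nil : items [] = [] := rfl
@[simp] theorem items_none (cs : List (Option ℕ)) : items (none :: cs) = items cs := rfl
@[simp] theorem items_some (y : ℕ) (cs : List (Option ℕ)) :
    items (some y :: cs) = y :: items cs := rfl
@[simp] theorem items_append (cs cs' : List (Option ℕ)) :
    items (cs ++ cs') = items cs ++ items cs' := List.reduceOption_append cs cs'

theorem length_items_le (cs : List (Option ℕ)) : (items cs).length ≤ cs.length :=
  List.reduceOption_length_le cs

theorem items_replicate (k : ℕ) : items (List.replicate k none) = [] := by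
  induction k with
  | zero => rfl
  | succ k ih => simpa [List.replicate_succ] using ih

/-- The cells `d`, `d + 1`, … of the array hold nodes of the right degree, except that the degree of
a root may be larger by one. -/
def CellsOk (N : ℕ → Option (Node K)) : ℕ → List (Option ℕ) → Prop
  | _, [] => True
  | d, none :: cs => CellsOk N (d + 1) cs
  | d, some y :: cs =>
    (dgOf N y = d ∨ (dgOf N y = d + 1 ∧ parOf N y = none)) ∧ CellsOk N (d + 1) cs

/-- The number of nodes whose degree is not the index of their cell. -/
def excess (N : ℕ → Option (Node K)) : ℕ → List (Option ℕ) → ℕ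
  | _, [] => 0
  | d, none :: cs => excess N (d + 1) cs
  | d, some y :: cs => (if dgOf N y = d then 0 else 1) + excess N (d + 1) cs

variable {N N' : ℕ → Option (Node K)}

theorem cellsOk_congr {cs : List (Option ℕ)} (h : ∀ y ∈ items cs, N' y = N y) (d : ℕ) :
    CellsOk N' d cs ↔ CellsOk N d cs := by
  induction cs generalizing d with
  | nil => rfl
  | cons c cs ih =>
    cases c with
    | none => exact ih h (d + 1)
    | some y =>
      have hy := h y (by simp)
      simp only [CellsOk, dgOf_congr hy, parOf_congr hy,
        ih (fun y hy => h y (List.mem_cons_of_mem _ hy)) (d + 1)]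

theorem excess_congr {cs : List (Option ℕ)} (h : ∀ y ∈ items cs, N' y = N y) (d : ℕ) :
    excess N' d cs = excess N d cs := by
  induction cs generalizing d with
  | nil => rfl
  | cons c cs ih =>
    cases c with
    | none => exact ih h (d + 1)
    | some y =>
      have hy := h y (by simp)
      simp only [excess, dgOf_congr hy,
        ih (fun y hy => h y (List.mem_cons_of_mem _ hy)) (d + 1)]

theorem cellsOk_append (cs cs' : List (Option ℕ)) (d : ℕ) :
    CellsOk N d (cs ++ cs') ↔ CellsOk N d cs ∧ CellsOk N (d + cs.length) cs' := by
  induction cs generalizing d with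
  | nil => simp [CellsOk]
  | cons c cs ih =>
    have : d + (c :: cs).length = d + 1 + cs.length := by simp only [List.length_cons]; omega
    cases c <;> simp [CellsOk, ih, this, and_assoc, -List.length_cons]

theorem excess_append (cs cs' : List (Option ℕ)) (d : ℕ) :
    excess N d (cs ++ cs') = excess N d cs + excess N (d + cs.length) cs' := by
  induction cs generalizing d with
  | nil => simp [excess]
  | cons c cs ih =>
    have : d + (c :: cs).length = d + 1 + cs.length := by simp only [List.length_cons]; omega
    cases c <;> simp [excess, ih, this, add_assoc, -List.length_cons]

theorem cellsOk_replicate (k d : ℕ) : CellsOk N d (List.replicate k none) := by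
  induction k generalizing d with
  | zero => trivial
  | succ k ih => exact ih (d + 1)

theorem excess_replicate (k d : ℕ) : excess N d (List.replicate k none) = 0 := by
  induction k generalizing d with
  | zero => rfl
  | succ k ih => exact ih (d + 1)

/-- The roots among the nodes in `S`. -/
def rootSet (S : Finset ℕ) (N : ℕ → Option (Node K)) : Finset ℕ :=
  S.filter fun x => parOf N x = none

theorem mem_rootSet {S : Finset ℕ} {x : ℕ} : x ∈ rootSet S N ↔ x ∈ S ∧ parOf N x = none := by
  simp [rootSet]

theorem card_rootSet_linked {S : Finset ℕ} {x y : ℕ} (hx : x ∈ S) (hl : (N x).isSome)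
    (hne : x ≠ y) (hp : parOf N x = none) :
    (rootSet S (linked N x y)).card + 1 = (rootSet S N).card := by
  have : rootSet S (linked N x y) = (rootSet S N).erase x := by
    ext a
    simp only [mem_rootSet, Finset.mem_erase, parOf_linked hl hne]
    by_cases hax : a = x <;> simp [hax]
  rw [this]
  exact Finset.card_erase_add_one (mem_rootSet.2 ⟨hx, hp⟩)

/-- What links do: keys stay, no root and no mark is created. -/
structure Evolves (N N' : ℕ → Option (Node K)) : Prop where
  key : ∀ w, keyOf N' w = keyOf N w
  par : ∀ w, parOf N' w = none → parOf N w = none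
  mark : ∀ w, mkOf N' w = true → mkOf N w = true

theorem Evolves.refl (N : ℕ → Option (Node K)) : Evolves N N :=
  ⟨fun _ => rfl, fun _ => id, fun _ => id⟩

theorem Evolves.trans {N'' : ℕ → Option (Node K)} (h : Evolves N N') (h' : Evolves N' N'') :
    Evolves N N'' :=
  ⟨fun w => (h'.key w).trans (h.key w), fun w hw => h.par w (h'.par w hw),
    fun w hw => h.mark w (h'.mark w hw)⟩

theorem Evolves.linked {x y : ℕ} (hx : (N x).isSome) (hne : x ≠ y) :
    Evolves N (linked N x y) := by
  refine ⟨keyOf_linked, fun w hw => ?_, fun w hw => ?_⟩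
  · rw [parOf_linked hx hne] at hw
    split_ifs at hw
    exact hw
  · rw [mkOf_linked hne] at hw
    split_ifs at hw
    exact hw

variable [LinearOrder K]

/-- The effect of APPEND of `x` on the records `N` and on the cells `cs` from the degree `d` of `x`
on: the records become `N'` and the cells become `some x :: cs'`. -/
structure Appended (S : Finset ℕ) (x d : ℕ) (N : ℕ → Option (Node K)) (cs : List (Option ℕ))
    (N' : ℕ → Option (Node K)) (cs' : List (Option ℕ)) : Prop where
  forest : Forest S N' none none
  evolves : Evolves N N'
  frame : ∀ w, w ≠ x → w ∉ items cs → N' w = N w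
  length : cs'.length + 1 = cs.length
  nodup : (items (some x :: cs')).Nodup
  sub : ∀ w ∈ items cs', w ∈ items cs
  ok : CellsOk N' d (some x :: cs')
  keep : ∀ w ∈ items cs, parOf N' w = none → w ∈ items cs'

variable {S : Finset ℕ} {R : List ℕ} {m : Option ℕ} {n : ℕ}

/-- Recursive calls go one cell further to the right, so the induction is on the number `k` of cells
after the current one. The `11` bounds the steps of one call apart from its recursive call, and each
recursive call is paid by a lost root or a repaired stale cell. The bound on degrees ranges over all
forests on `S`, since links change the records before the recursion. Distinctness is demanded only
from the current cell on, because during the recursion `y` sits in its old cell as well as in the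
next one. -/
theorem ends_append (k : ℕ) :
    ∀ (post : List (Option ℕ)) (c : Option ℕ) (pre : List (Option ℕ)) (x : ℕ)
      (N : ℕ → Option (Node K)) (t : ℕ), post.length = k → Forest S N none none →
      (∀ N' : ℕ → Option (Node K), Forest S N' none none →
        ∀ y ∈ S, dgOf N' y < (pre ++ c :: post).length) →
      x ∈ S → parOf N x = none → dgOf N x = pre.length → (items (c :: post)).Nodup →
      (∀ y ∈ items (c :: post), y ∈ S ∧ y ≠ x) → CellsOk N pre.length (c :: post) →
      Ends (append x pre.length) ⟨⟨N, R, m, n⟩, pre ++ c :: post, t⟩ fun _ s' =>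
        ∃ N' cs' t', s' = ⟨⟨N', R, m, n⟩, pre ++ some x :: cs', t'⟩ ∧
          Appended S x pre.length N (c :: post) N' cs' ∧
          t' + 11 * ((rootSet S N').card + excess N' pre.length (some x :: cs')) ≤
            t + 11 * ((rootSet S N).card + excess N pre.length (c :: post)) + 11 := by
  induction k using Nat.strong_induction_on with
  | _ k ih =>
  intro post c pre x N t hk hF hB hx hp hd hnd hsub hok
  have hget : (pre ++ c :: post)[pre.length]? = some c := by simp
  have hset : ∀ (a b : Option ℕ) (cs : List (Option ℕ)),
      (pre ++ a :: cs).set pre.length b = pre ++ b :: cs := fun a b cs => by simp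
  rw [append, ends_bind, ends_readArray hget]
  cases c with
  | none =>
    dsimp only
    rw [ends_writeArray (by simp), hset]
    refine ⟨N, post, _, rfl, ⟨hF, .refl N, fun _ _ _ => rfl, rfl, ?_, fun w hw => hw, ?_,
      fun w hw _ => hw⟩, ?_⟩
    · exact List.nodup_cons.2 ⟨fun h => (hsub x h).2 rfl, hnd⟩
    · exact ⟨Or.inl hd, hok⟩
    · simp only [excess, hd, if_true]; omega
  | some y =>
    obtain ⟨hyS, hyx⟩ := hsub y (by simp)
    obtain ⟨hyd, hok⟩ := hok
    obtain ⟨hypost, hnd⟩ := List.nodup_cons.1 hnd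
    have hxpost : x ∉ items post := fun h => (hsub x (List.mem_cons_of_mem _ h)).2 rfl
    have hxl := hF.live x hx
    have hyl := hF.live y hyS
    obtain ⟨v, hv⟩ := Option.isSome_iff_exists.1 hyl
    dsimp only
    rw [ends_bind]
    by_cases hless : lt N y x
    · rw [ends_less_of_lt hyl hxl hless, if_pos rfl, ends_bind, ends_readNode hv]
      -- The common continuation for `y < x`, with or without a link. The last hypothesis says that
      -- one unit of potential has been released, which the recursive call will consume; the `9`
      -- leaves two steps for the second read of `y` and the final write.
      have cont : ∀ (N₁ : ℕ → Option (Node K)) (t₁ : ℕ), Forest S N₁ none none → Evolves N N₁ →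
          (∀ w, w ≠ x → w ≠ y → N₁ w = N w) → dgOf N₁ x = pre.length → parOf N₁ y = parOf N y →
          (parOf N y = none → dgOf N₁ y = pre.length + 1) →
          t₁ + 11 * ((rootSet S N₁).card + 1) ≤ t + 9 + 11 * ((rootSet S N).card +
            if dgOf N y = pre.length then 0 else 1) →
          Ends (do
            let w ← readNode y
            if w.parent = none then do
              append y w.degree
              writeArray pre.length (some x)
            else writeArray pre.length (some x)) ⟨⟨N₁, R, m, n⟩, pre ++ some y :: post, t₁⟩
          fun _ s' => ∃ N' cs' t', s' = ⟨⟨N', R, m, n⟩, pre ++ some x :: cs', t'⟩ ∧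
            Appended S x pre.length N (some y :: post) N' cs' ∧
            t' + 11 * ((rootSet S N').card + excess N' pre.length (some x :: cs')) ≤
              t + 11 * ((rootSet S N).card + excess N pre.length (some y :: post)) + 11 := by
        intro N₁ t₁ hF₁ hE hfr hdx hpy hdy ht
        have hpost : ∀ w ∈ items post, N₁ w = N w := fun w hw => by
          refine hfr w ?_ ?_
          · rintro rfl; exact hxpost hw
          · rintro rfl; exact hypost hw
        have hok₁ := (cellsOk_congr hpost (pre.length + 1)).2 hok
        have hex := excess_congr hpost (pre.length + 1)
        obtain ⟨w, hw⟩ := Option.isSome_iff_exists.1 (hF₁.live y hyS)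
        rw [ends_bind, ends_readNode hw]
        by_cases hwp : w.parent = none
        · have hpy₁ : parOf N₁ y = none := (parOf_eq hw).trans hwp
          have hdy₁ := hdy (hpy ▸ hpy₁)
          -- The degree of `y` is now the index of the next cell, so the degree bound forces that
          -- cell to exist.
          have hb := hB N₁ hF₁ y hyS
          cases post with
          | nil => simp [hdy₁] at hb
          | cons c' post =>
            rw [if_pos hwp, ends_bind]
            have hwd : w.degree = (pre ++ [some y]).length := by
              rw [← dgOf_eq hw, hdy₁]; simp
            have hlen : (pre ++ [some y]).length = pre.length + 1 := by simp
            have harr : pre ++ some y :: c' :: post = (pre ++ [some y]) ++ c' :: post := by simp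
            rw [hwd, harr]
            refine (ih post.length (by simp at hk; omega) post c' (pre ++ [some y]) y N₁ (t₁ + 1)
              rfl hF₁ (by rw [← harr]; exact hB) hyS hpy₁ (by rw [hdy₁, hlen]) hnd
              (fun a ha => ⟨(hsub a (List.mem_cons_of_mem _ ha)).1, by
                rintro rfl; exact hypost ha⟩) (by rw [hlen]; exact hok₁)).mono ?_
            rintro - s' ⟨N₂, cs, t₂, rfl, hA, hcost⟩
            rw [hlen] at hA hcost
            -- The recursion alters only `y` and the occupants of later cells, and `x` is none of
            -- them; hence `x` still has the degree of its cell when it is written.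
            have hx₂ : N₂ x = N₁ x := hA.frame x hyx.symm hxpost
            have harr' : (pre ++ [some y]) ++ some y :: cs = pre ++ some y :: some y :: cs := by
              simp
            rw [harr', ends_writeArray (by simp), hset]
            refine ⟨N₂, some y :: cs, _, rfl, ⟨hA.forest, hE.trans hA.evolves, ?_, ?_, ?_, ?_, ?_,
              ?_⟩, ?_⟩
            · intro a hax ha
              simp only [items_some, List.mem_cons, not_or] at ha
              rw [hA.frame a ha.1 ha.2, hfr a hax ha.1]
            · exact congrArg (· + 1) hA.length
            · refine List.nodup_cons.2 ⟨fun h => ?_, hA.nodup⟩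
              rcases List.mem_cons.1 h with h | h
              · exact hyx h.symm
              · exact hxpost (hA.sub x h)
            · intro a ha
              rcases List.mem_cons.1 ha with rfl | ha
              · exact List.mem_cons_self
              · exact List.mem_cons_of_mem _ (hA.sub a ha)
            · exact ⟨Or.inl (by rw [dgOf_congr hx₂, hdx]), hA.ok⟩
            · intro a ha hpa
              rcases List.mem_cons.1 ha with rfl | ha
              · exact List.mem_cons_self
              · exact List.mem_cons_of_mem _ (hA.keep a ha hpa)
            · have h1 : excess N₂ pre.length (some x :: some y :: cs) =
                  excess N₂ (pre.length + 1) (some y :: cs) := by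
                rw [excess, if_pos (by rw [dgOf_congr hx₂, hdx]), zero_add]
              have h2 : excess N pre.length (some y :: c' :: post) =
                  (if dgOf N y = pre.length then 0 else 1) +
                    excess N (pre.length + 1) (c' :: post) := rfl
              rw [h1, h2]
              rw [hex] at hcost
              omega
        · rw [if_neg hwp, ends_writeArray (by simp), hset]
          have hpy₁ : parOf N₁ y ≠ none := fun h => hwp ((parOf_eq hw).symm.trans h)
          refine ⟨N₁, post, _, rfl, ⟨hF₁, hE, ?_, rfl, ?_, fun a ha => List.mem_cons_of_mem _ ha,
            ⟨Or.inl hdx, hok₁⟩, ?_⟩, ?_⟩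
          · intro a hax ha
            simp only [items_some, List.mem_cons, not_or] at ha
            exact hfr a hax ha.1
          · exact List.nodup_cons.2 ⟨hxpost, hnd⟩
          · intro a ha hpa
            rcases List.mem_cons.1 ha with rfl | ha
            · exact absurd hpa hpy₁
            · exact ha
          · simp only [excess, hdx, if_true, hex]
            omega
      by_cases hvd : v.degree = pre.length
      · have hdy : dgOf N y = pre.length := (dgOf_eq hv).trans hvd
        rw [if_pos hvd, ends_bind, ends_link hxl hyl hyx.symm]
        refine cont (linked N x y) _ (hF.linked hx hyS hp hless (by omega)) (.linked hxl hyx.symm)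
          (fun w hwx hwy => linked_of_ne hwx hwy) ?_ ?_ ?_ ?_
        · rw [dgOf_linked hyl, if_neg hyx.symm, hd]
        · rw [parOf_linked hxl hyx.symm, if_neg hyx]
        · intro _; rw [dgOf_linked hyl, if_pos rfl, hdy]
        · rw [card_rootSet_linked hx hxl hyx.symm hp, if_pos hdy]
          omega
      · have hdy : dgOf N y ≠ pre.length := fun h => hvd ((dgOf_eq hv).symm.trans h)
        rw [if_neg hvd]
        -- No link, but `y` was stale: its unit of `excess` pays for moving it to the next cell.
        refine cont N _ hF (.refl N) (fun _ _ _ => rfl) hd rfl (fun _ => (hyd.resolve_left hdy).1) ?_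
        rw [if_neg hdy]
        omega
    · have hxy := lt_of_not_lt hyl hxl hyx hless
      rw [ends_less_of_not_lt hyl hxl hless, if_neg (by simp), ends_bind, ends_readNode hv]
      by_cases hvp : v.parent = none
      · have hpy : parOf N y = none := (parOf_eq hv).trans hvp
        have hpost : ∀ w ∈ items post, linked N y x w = N w := fun w hw => by
          refine linked_of_ne ?_ ?_
          · rintro rfl; exact hypost hw
          · rintro rfl; exact hxpost hw
        have hdx : dgOf (linked N y x) x = pre.length + 1 := by
          rw [dgOf_linked hxl, if_pos rfl, hd]
        rw [if_pos hvp, ends_bind, ends_link hyl hxl hyx, ends_writeArray (by simp), hset]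
        refine ⟨linked N y x, post, _, rfl, ⟨hF.linked hyS hx hpy hxy (by omega),
          .linked hyl hyx, ?_, rfl, List.nodup_cons.2 ⟨hxpost, hnd⟩,
          fun a ha => List.mem_cons_of_mem _ ha,
          ⟨Or.inr ⟨hdx, ?_⟩, (cellsOk_congr hpost (pre.length + 1)).2 hok⟩, ?_⟩, ?_⟩
        · intro a hax ha
          simp only [items_some, List.mem_cons, not_or] at ha
          exact linked_of_ne ha.1 hax
        · rw [parOf_linked hyl hyx, if_neg hyx.symm, hp]
        · intro a ha hpa
          rcases List.mem_cons.1 ha with rfl | ha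
          · simp [parOf_linked hyl hyx] at hpa
          · exact ha
        -- The lost root `y` pays for the staleness of `x`, whether or not `y` was stale itself.
        · have h1 := card_rootSet_linked hyS hyl hyx hpy
          rw [excess, excess, if_neg (by omega), excess_congr hpost]
          split_ifs <;> omega
      · have hpy : parOf N y ≠ none := fun h => hvp ((parOf_eq hv).symm.trans h)
        rw [if_neg hvp, ends_writeArray (by simp), hset]
        refine ⟨N, post, _, rfl, ⟨hF, .refl N, fun _ _ _ => rfl, rfl,
          List.nodup_cons.2 ⟨hxpost, hnd⟩, fun a ha => List.mem_cons_of_mem _ ha,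
          ⟨Or.inl hd, hok⟩, ?_⟩, ?_⟩
        · intro a ha hpa
          rcases List.mem_cons.1 ha with rfl | ha
          · exact absurd hpa hpy
          · exact ha
        · simp only [excess, hd, if_true]
          omega

end Cells

/-! ### Consolidation -/

section Consolidate

variable {K : Type} [LinearOrder K] {S : Finset ℕ} {R : List ℕ} {m : Option ℕ} {n : ℕ}

/-- Every root is either still waiting in `l` or stored in a cell. Waiting roots are in no cell, so
the frame property of APPEND keeps their records intact. Each of them costs one read and an
amortized `11`; the initial roots and stale cells cover the recursive calls. -/
theorem ends_forM_append (l : List ℕ) :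
    ∀ (A : List (Option ℕ)) (N : ℕ → Option (Node K)) (t : ℕ), Forest S N none none →
      (∀ N' : ℕ → Option (Node K), Forest S N' none none → ∀ y ∈ S, dgOf N' y < A.length) →
      l.Nodup → (∀ x ∈ l, x ∈ S ∧ parOf N x = none ∧ x ∉ items A) → (items A).Nodup →
      (∀ y ∈ items A, y ∈ S) → CellsOk N 0 A →
      (∀ x ∈ S, parOf N x = none → x ∈ l ∨ x ∈ items A) →
      Ends (l.forM fun x => do
        let v ← readNode x
        append x v.degree) ⟨⟨N, R, m, n⟩, A, t⟩ fun _ s' =>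
        ∃ N' A' t', s' = ⟨⟨N', R, m, n⟩, A', t'⟩ ∧ A'.length = A.length ∧
          Forest S N' none none ∧ Evolves N N' ∧ (items A').Nodup ∧ (∀ y ∈ items A', y ∈ S) ∧
          (∀ x ∈ S, parOf N' x = none → x ∈ items A') ∧
          t' ≤ t + 11 * ((rootSet S N).card + excess N 0 A) + 12 * l.length := by
  induction l with
  | nil =>
    intro A N t hF hB _ _ hnd hsub _ hall
    rw [List.forM_eq_forM, List.forM_nil, ends_pure]
    exact ⟨N, A, t, rfl, rfl, hF, .refl N, hnd, hsub,
      fun x hx hp => (hall x hx hp).resolve_left (by simp), by omega⟩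
  | cons x l ih =>
    intro A N t hF hB hl hroot hnd hsub hok hall
    obtain ⟨hx, hp, hxA⟩ := hroot x (by simp)
    obtain ⟨hxl, hl⟩ := List.nodup_cons.1 hl
    obtain ⟨v, hv⟩ := Option.isSome_iff_exists.1 (hF.live x hx)
    rw [List.forM_eq_forM, List.forM_cons, ends_bind, ends_bind, ends_readNode hv, ← dgOf_eq hv]
    have hd := hB N hF x hx
    obtain ⟨pre, c, post, rfl, hlen⟩ : ∃ pre c post, A = pre ++ c :: post ∧
        pre.length = dgOf N x :=
      ⟨A.take (dgOf N x), A[dgOf N x], A.drop (dgOf N x + 1), by simp, by simp; omega⟩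
    rw [items_append] at hnd hsub hxA
    obtain ⟨hnd₁, hnd₂, hdisj⟩ := List.nodup_append'.1 hnd
    rw [cellsOk_append, zero_add] at hok
    rw [← hlen]
    refine (ends_append post.length post c pre x N (t + 1) rfl hF hB hx hp hlen.symm hnd₂
      (fun y hy => ⟨hsub y (List.mem_append_right _ hy), ?_⟩) hok.2).mono ?_
    · rintro rfl
      exact hxA (List.mem_append_right _ hy)
    rintro - s' ⟨N₁, cs, t₁, rfl, hA, hcost⟩
    have hpre : ∀ y ∈ items pre, N₁ y = N y := fun y hy => by
      refine hA.frame y ?_ fun h => hdisj hy h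
      rintro rfl
      exact hxA (List.mem_append_left _ hy)
    have hlen₁ : (pre ++ some x :: cs).length = (pre ++ c :: post).length := by
      have := hA.length
      simp only [List.length_append, List.length_cons] at this ⊢
      omega
    have hitem : ∀ y ∈ items (pre ++ some x :: cs), y = x ∨ y ∈ items (pre ++ c :: post) := by
      intro y hy
      rw [items_append] at hy ⊢
      rcases List.mem_append.1 hy with hy | hy
      · exact Or.inr (List.mem_append_left _ hy)
      · rcases List.mem_cons.1 hy with hy | hy
        · exact Or.inl hy
        · exact Or.inr (List.mem_append_right _ (hA.sub y hy))
    refine (ih (pre ++ some x :: cs) N₁ t₁ hA.forest (by rw [hlen₁]; exact hB) hl ?_ ?_ ?_ ?_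
      ?_).mono ?_
    · intro y hy
      obtain ⟨h1, h2, h3⟩ := hroot y (List.mem_cons_of_mem _ hy)
      have hyx : y ≠ x := by rintro rfl; exact hxl hy
      refine ⟨h1, ?_, fun h => ?_⟩
      · rw [parOf_congr (hA.frame y hyx fun h => h3 ?_), h2]
        rw [items_append]
        exact List.mem_append_right _ h
      · exact (hitem y h).elim hyx h3
    · rw [items_append, List.nodup_append']
      refine ⟨hnd₁, hA.nodup, fun y hy hy' => ?_⟩
      rcases List.mem_cons.1 hy' with rfl | hy'
      · exact hxA (List.mem_append_left _ hy)
      · exact hdisj hy (hA.sub y hy')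
    · intro y hy
      rcases hitem y hy with rfl | hy
      · exact hx
      · rw [items_append] at hy
        exact hsub y hy
    · rw [cellsOk_append, zero_add]
      exact ⟨(cellsOk_congr hpre 0).2 hok.1, hA.ok⟩
    · intro y hy hpy
      rw [items_append]
      rcases hall y hy (hA.evolves.par y hpy) with h | h
      · rcases List.mem_cons.1 h with rfl | h
        · exact Or.inr (List.mem_append_right _ List.mem_cons_self)
        · exact Or.inl h
      · rw [items_append] at h
        refine Or.inr ?_
        rcases List.mem_append.1 h with h | h
        · exact List.mem_append_left _ h
        · exact List.mem_append_right _ (List.mem_cons_of_mem _ (hA.keep y h hpy))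
    · rintro - s' ⟨N', A', t', rfl, h1, h2, h3, h4, h5, h6, h7⟩
      refine ⟨N', A', t', rfl, h1.trans hlen₁, h2, hA.evolves.trans h3, h4, h5, h6, ?_⟩
      rw [excess_append, zero_add] at h7 ⊢
      rw [excess_congr hpre] at h7
      rw [List.length_cons]
      omega

/-- `T` stands for the candidates that the minimum pointer has already been compared with. The `8`
is two reads, one insertion and at most five steps for the minimum. -/
theorem ends_forM_collect {N : ℕ → Option (Node K)} (cs : List (Option ℕ)) :
    ∀ (pre : List (Option ℕ)) (R : List ℕ) (m t : ℕ) (T : Finset ℕ), LeastOn N T m →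
      (∀ x ∈ T, (N x).isSome) → (∀ x ∈ items cs, (N x).isSome) →
      Ends ((List.range' pre.length cs.length).forM fun i => do
        match ← readArray i with
        | none => pure ()
        | some x =>
          let v ← readNode x
          if v.parent = none then
            addRoot x
            updateMin x) ⟨⟨N, R, some m, n⟩, pre ++ cs, t⟩ fun _ s' =>
        ∃ m' t', s' = ⟨⟨N, R ++ (items cs).filter fun x => parOf N x = none, some m', n⟩,
            pre ++ cs, t'⟩ ∧
          LeastOn N (T ∪ ((items cs).filter fun x => parOf N x = none).toFinset) m' ∧
          t' ≤ t + 8 * cs.length := by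
  induction cs with
  | nil =>
    intro pre R m t T hm _ _
    rw [List.length_nil, List.range'_zero, List.forM_eq_forM, List.forM_nil, ends_pure]
    exact ⟨m, t, by simp, by simpa using hm, by omega⟩
  | cons c cs ih =>
    intro pre R m t T hm hT hl
    have hget : (pre ++ c :: cs)[pre.length]? = some c := by simp
    have harr : pre ++ c :: cs = (pre ++ [c]) ++ cs := by simp
    have hlen : (pre ++ [c]).length = pre.length + 1 := by simp
    rw [List.length_cons, List.range'_succ, List.forM_eq_forM, List.forM_cons, ends_bind, ends_bind,
      ends_readArray hget, harr, ← hlen]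
    cases c with
    | none =>
      rw [ends_pure]
      refine (ih (pre ++ [none]) R m (t + 1) T hm hT hl).mono ?_
      rintro - s' ⟨m', t', rfl, h1, h2⟩
      exact ⟨m', t', rfl, h1, by omega⟩
    | some x =>
      have hxl : (N x).isSome := hl x List.mem_cons_self
      have hl' : ∀ y ∈ items cs, (N y).isSome := fun y hy => hl y (List.mem_cons_of_mem _ hy)
      obtain ⟨v, hv⟩ := Option.isSome_iff_exists.1 hxl
      dsimp only
      rw [ends_bind, ends_readNode hv]
      by_cases hp : v.parent = none
      · have hpx : parOf N x = none := (parOf_eq hv).trans hp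
        rw [if_pos hp, ends_bind, ends_addRoot]
        refine ends_updateMin hxl (fun a ha => ?_) fun t₁ ht₁ => ?_
        · obtain rfl : m = a := by simpa using ha
          exact hT m hm.1
        refine (ih (pre ++ [some x]) (R ++ [x]) _ t₁ (T ∪ {x})
          (hm.union (.singleton N x) (hT m hm.1) hxl) (fun y hy => ?_) hl').mono ?_
        · rcases Finset.mem_union.1 hy with hy | hy
          · exact hT y hy
          · exact Finset.mem_singleton.1 hy ▸ hxl
        rintro - s' ⟨m', t', rfl, h1, h2⟩
        refine ⟨m', t', ?_, ?_, by omega⟩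
        · simp [hpx]
        · convert h1 using 1
          ext a
          simp [hpx]
      · have hpx : parOf N x ≠ none := fun h => hp ((parOf_eq hv).symm.trans h)
        rw [if_neg hp, ends_pure]
        refine (ih (pre ++ [some x]) R m _ T hm hT hl').mono ?_
        rintro - s' ⟨m', t', rfl, h1, h2⟩
        refine ⟨m', t', ?_, ?_, by omega⟩
        · simp [hpx]
        · simpa [hpx] using h1

/-- The factor `23` is `12` for each root handed to APPEND plus `11` for its initial potential. Each
of the `D n + 1` cells contributes at most one new root. -/
theorem ends_consolidate {N : ℕ → Option (Node K)} {A : List (Option ℕ)} {r t : ℕ}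
    (hF : Forest S N none none) (hn : S.card ≤ n) (hnd : R.Nodup)
    (hR : ∀ x, x ∈ R ↔ x ∈ S ∧ parOf N x = none) (hr : r ∈ S) :
    Ends consolidate ⟨⟨N, R, some r, n⟩, A, t⟩ fun _ s' =>
      ∃ N' R' m' A' t', s' = ⟨⟨N', R', some m', n⟩, A', t'⟩ ∧ Forest S N' none none ∧
        Evolves N N' ∧ R'.Nodup ∧ (∀ x, x ∈ R' ↔ x ∈ S ∧ parOf N' x = none) ∧ LeastOn N' S m' ∧
        R'.length ≤ D n + 1 ∧ t' ≤ t + 23 * R.length + 9 * D n + 13 := by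
  have hcard : (rootSet S N).card = R.length := by
    rw [← List.toFinset_card_of_nodup hnd]
    congr 1
    ext x
    rw [mem_rootSet, List.mem_toFinset, hR]
  have hlen : (List.replicate (D n + 1) (none : Option ℕ)).length = D n + 1 := by simp
  unfold consolidate
  rw [ends_bind, ends_readSize, ends_bind, ends_newArray, ends_bind, ends_rootList, ends_bind]
  refine (ends_forM_append R (List.replicate (D n + 1) none) N _ hF (fun N' hN' y hy => ?_) hnd
    (fun x hx => ⟨((hR x).1 hx).1, ((hR x).1 hx).2, ?_⟩) ?_ ?_ (cellsOk_replicate _ _)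
    (fun x hx hp => Or.inl ((hR x).2 ⟨hx, hp⟩))).mono ?_
  · rw [hlen]
    exact Nat.lt_succ_of_le (hN'.dgOf_le hn hy)
  · simp [items_replicate]
  · simp [items_replicate]
  · simp [items_replicate]
  rintro - s' ⟨N', A', t', rfl, h1, h2, h3, h4, h5, h6, h7⟩
  rw [hlen] at h1
  rw [excess_replicate, hcard] at h7
  rw [ends_bind, ends_clearRoots, List.range_eq_range', ← h1]
  -- The scan starts from the old right neighbour `r`, which may have become a child by now, so it
  -- is counted as a separate candidate.
  refine (ends_forM_collect A' [] [] r (t' + 1) {r} (.singleton N' r) (fun x hx => ?_)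
    (fun x hx => h2.live x (h5 x hx))).mono ?_
  · exact h2.live x (Finset.mem_singleton.1 hx ▸ hr)
  rintro - s' ⟨m', t'', rfl, hm, ht⟩
  have hmem : ∀ x, x ∈ (items A').filter (fun x => parOf N' x = none) ↔
      x ∈ S ∧ parOf N' x = none := fun x => by
    simp only [List.mem_filter, decide_eq_true_eq]
    exact ⟨fun h => ⟨h5 x h.1, h.2⟩, fun h => ⟨h6 x h.1 h.2, h.2⟩⟩
  refine ⟨N', _, m', A', t'', rfl, h2, h3, h4.filter _, hmem, ?_, ?_, by omega⟩
  -- The least node `μ` is a root, hence among the candidates, and every candidate lies in `S`; so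
  -- the scan must have ended at `μ`.
  · obtain ⟨μ, hμ⟩ := exists_leastOn ⟨r, hr⟩ h2.live
    have hm'S : m' ∈ S := by
      rcases Finset.mem_union.1 hm.1 with h | h
      · exact Finset.mem_singleton.1 h ▸ hr
      · exact ((hmem m').1 (List.mem_toFinset.1 h)).1
    have hμR := (hmem μ).2 ⟨hμ.1, h2.parOf_least hμ⟩
    have : μ = m' := by
      by_contra hne
      exact lt_asymm (hμ.2 m' hm'S (Ne.symm hne))
        (hm.2 μ (Finset.mem_union_right _ (List.mem_toFinset.2 hμR)) hne)
    exact this ▸ hμ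
  · have := List.length_filter_le (fun x => decide (parOf N' x = none)) (items A')
    have := length_items_le A'
    simp only [List.nil_append]
    omega

end Consolidate

/-! ### The heap invariant, the potential, and the simple operations -/

section Invariant

variable {K : Type}

/-- The number of marked nodes in `S`. -/
def marks (S : Finset ℕ) (N : ℕ → Option (Node K)) : ℕ := (S.filter fun x => mkOf N x = true).card

theorem marks_le_of_imp {S : Finset ℕ} {N N' : ℕ → Option (Node K)}
    (h : ∀ x ∈ S, mkOf N' x = true → mkOf N x = true) : marks S N' ≤ marks S N := by
  refine Finset.card_le_card fun x hx => ?_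
  rw [Finset.mem_filter] at hx ⊢
  exact ⟨hx.1, h x hx.1 hx.2⟩

theorem marks_mono {S T : Finset ℕ} (N : ℕ → Option (Node K)) (h : S ⊆ T) :
    marks S N ≤ marks T N :=
  Finset.card_le_card (Finset.filter_subset_filter _ h)

theorem marks_union_le (S T : Finset ℕ) (N : ℕ → Option (Node K)) :
    marks (S ∪ T) N ≤ marks S N + marks T N := by
  unfold marks
  rw [Finset.filter_union]
  exact Finset.card_union_le _ _

theorem marks_severed {S : Finset ℕ} {N : ℕ → Option (Node K)} {x y : ℕ} (hx : x ∈ S)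
    (hm : mkOf N x = true) : marks S (severed N x y) + 1 = marks S N := by
  have : (S.filter fun a => mkOf (severed N x y) a = true) =
      (S.filter fun a => mkOf N a = true).erase x := by
    ext a
    simp only [Finset.mem_filter, Finset.mem_erase, mkOf_severed]
    by_cases hax : a = x <;> simp [hax]
  rw [marks, this]
  exact Finset.card_erase_add_one (Finset.mem_filter.2 ⟨hx, hm⟩)

theorem marks_update_le {S : Finset ℕ} {N : ℕ → Option (Node K)} {x : ℕ} {v : Node K} :
    marks S (Function.update N x (some v)) ≤ marks S N + 1 := by
  refine (Finset.card_le_card (t := Insert.insert x (S.filter fun a => mkOf N a = true))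
    fun a ha => ?_).trans (Finset.card_insert_le _ _)
  rw [Finset.mem_filter, mkOf_update] at ha
  rw [Finset.mem_insert, Finset.mem_filter]
  by_cases hax : a = x
  · exact Or.inl hax
  · rw [if_neg hax] at ha
    exact Or.inr ha

/-- Finite support turns the `ncard` of the definition into a genuine count. -/
theorem potential_eq {S : Finset ℕ} {H : Heap K} (h : ∀ x ∉ S, H.nodes x = none) :
    potential H = H.roots.length + 2 * marks S H.nodes := by
  have : {x : ℕ | ∃ v, H.nodes x = some v ∧ v.mark = true} =
      ((S.filter fun x => mkOf H.nodes x = true : Finset ℕ) : Set ℕ) := by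
    ext x
    simp only [Set.mem_ofPred_eq, Finset.coe_filter]
    constructor
    · rintro ⟨v, hv, hm⟩
      refine ⟨?_, (mkOf_eq hv).trans hm⟩
      by_contra hx
      simp [h x hx] at hv
    · rintro ⟨-, hm⟩
      cases hv : H.nodes x with
      | none => simp [mkOf, hv] at hm
      | some v => exact ⟨v, rfl, (mkOf_eq hv).symm.trans hm⟩
  rw [potential, this, Set.ncard_coe_finset]
  rfl

variable [LinearOrder K]

/-- The invariant of the heaps that arise; `S` is the set of nodes. -/
structure Inv (S : Finset ℕ) (H : Heap K) : Prop where
  forest : Forest S H.nodes none none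
  support : ∀ x ∉ S, H.nodes x = none
  nodup : H.roots.Nodup
  roots : ∀ x, x ∈ H.roots ↔ x ∈ S ∧ parOf H.nodes x = none
  least : ∀ m, H.min = some m → LeastOn H.nodes S m
  empty : H.min = none → S = ∅
  size : H.n = S.card

theorem Forest.congr {S : Finset ℕ} {N N' : ℕ → Option (Node K)} {e o : Option ℕ}
    (h : Forest S N e o) (hN : ∀ x ∈ S, N' x = N x) : Forest S N' e o := by
  refine ⟨fun x hx => ?_, fun x hx => ?_, fun x hx => ?_, fun x hx c hc => ?_, fun c hc p hp => ?_,
    fun c hc p hp ho => ?_, fun x hx i c hi => ?_⟩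
  · rw [hN x hx]; exact h.live x hx
  · rw [dgOf_congr (hN x hx), chOf_congr (hN x hx)]; exact h.deg x hx
  · rw [chOf_congr (hN x hx)]; exact h.nodup x hx
  · rw [chOf_congr (hN x hx)] at hc
    obtain ⟨h1, h2⟩ := h.child x hx c hc
    exact ⟨h1, (parOf_congr (hN c h1)).trans h2⟩
  · rw [parOf_congr (hN c hc)] at hp
    obtain ⟨h1, h2⟩ := h.parent c hc p hp
    exact ⟨h1, by rwa [chOf_congr (hN p h1)]⟩
  · rw [parOf_congr (hN c hc)] at hp
    exact (lt_congr (keyOf_congr (hN p (h.parent c hc p hp).1)) (keyOf_congr (hN c hc))).2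
      (h.order c hc p hp ho)
  · rw [chOf_congr (hN x hx)] at hi
    have hc := (h.child x hx c (List.mem_of_getElem? hi)).1
    rw [dgOf_congr (hN c hc), mkOf_congr (hN c hc)]
    exact h.index x hx i c hi

theorem Forest.union {S T : Finset ℕ} {N : ℕ → Option (Node K)} (h : Forest S N none none)
    (h' : Forest T N none none) : Forest (S ∪ T) N none none := by
  simp only [Finset.union_comm S T]
  constructor
  all_goals intro x hx
  all_goals rcases Finset.mem_union.1 hx with hx | hx
  · exact h'.live x hx
  · exact h.live x hx
  · exact h'.deg x hx
  · exact h.deg x hx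
  · exact h'.nodup x hx
  · exact h.nodup x hx
  · exact fun c hc => (h'.child x hx c hc).imp (Finset.mem_union_left _) id
  · exact fun c hc => (h.child x hx c hc).imp (Finset.mem_union_right _) id
  · exact fun p hp => (h'.parent x hx p hp).imp (Finset.mem_union_left _) id
  · exact fun p hp => (h.parent x hx p hp).imp (Finset.mem_union_right _) id
  · exact h'.order x hx
  · exact h.order x hx
  · exact h'.index x hx
  · exact h.index x hx

theorem Forest.singleton {N : ℕ → Option (Node K)} {x : ℕ} {v : Node K} (hx : N x = some v)
    (hp : v.parent = none) (hc : v.children = []) (hd : v.degree = 0) :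
    Forest {x} N none none := by
  have hpar := (parOf_eq hx).trans hp
  have hch := (chOf_eq hx).trans hc
  constructor
  all_goals
    intro a ha
    obtain rfl := Finset.mem_singleton.1 ha
  · simp [hx]
  · rw [dgOf_eq hx, hch, hd, List.length_nil]
  · simp [hch]
  · simp [hch]
  · simp [hpar]
  · simp [hpar]
  · simp [hch]

theorem inv_emptyHeap : Inv ∅ (emptyHeap : Heap K) := by
  refine ⟨⟨?_, ?_, ?_, ?_, ?_, ?_, ?_⟩, fun _ _ => rfl, List.nodup_nil, ?_, ?_, fun _ => rfl, rfl⟩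
  all_goals simp [emptyHeap]

theorem potential_emptyHeap : potential (emptyHeap : Heap K) = 0 := by
  rw [potential_eq inv_emptyHeap.support]
  rfl

/-- The potential per root that pays for its part of a consolidation. -/
abbrev rate : ℕ := 23

/-- From the heap `H`, the program `p` terminates in a heap that satisfies the invariant, and its
amortized running time is at most `B`, if `Φ` is the potential before. -/
def Amortized {α : Type} (p : Prog K α) (H : Heap K) (Φ B : ℕ) : Prop :=
  Ends p ⟨H, [], 0⟩ fun _ s' =>
    (∃ S, Inv S s'.heap) ∧ s'.time + rate * potential s'.heap ≤ rate * Φ + B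

theorem amortized_findMin {S : Finset ℕ} {H : Heap K} (h : Inv S H) :
    Amortized findMin H (potential H) 1 := by
  obtain ⟨N, R, m, n⟩ := H
  unfold Amortized findMin
  rw [ends_readMin]
  exact ⟨⟨S, h⟩, by dsimp only; omega⟩

theorem amortized_insert {S : Finset ℕ} {H : Heap K} (h : Inv S H) {x : ℕ} (k : K)
    (hx : H.nodes x = none) : Amortized (AdaptiveFib.insert x k) H (potential H) 40 := by
  obtain ⟨N, R, m, n⟩ := H
  have hxS : x ∉ S := fun hS => by simpa [show N x = none from hx] using h.forest.live x hS
  set v : Node K := { key := k, parent := none, children := [], degree := 0, mark := false } with hv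
  set N' := Function.update N x (some v) with hN'
  have hx' : N' x = some v := by simp [hN']
  have hold : ∀ a ∈ S, N' a = N a := fun a ha => by
    have : a ≠ x := by rintro rfl; exact hxS ha
    simp [hN', this]
  have hF := (h.forest.congr hold).union (.singleton hx' rfl rfl rfl)
  unfold Amortized AdaptiveFib.insert
  simp only [ends_bind, ends_writeNode, ends_addRoot]
  refine ends_updateMin (by simp) (fun a ha => ?_) fun t ht => ?_
  · exact hF.live a (Finset.mem_union_left _ (h.least a ha).1)
  simp only [ends_readSize, ends_writeSize]
  have hI : Inv (S ∪ {x}) ⟨N', R ++ [x], some (minOf N' m x), n + 1⟩ := by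
    refine ⟨hF, fun a ha => ?_, ?_, fun a => ?_, fun a ha => ?_, by simp, ?_⟩
    · rw [Finset.mem_union, not_or, Finset.mem_singleton] at ha
      simp only [hN', Function.update_of_ne ha.2]
      exact h.support a ha.1
    · refine List.nodup_append'.2 ⟨h.nodup, List.nodup_singleton x, fun a ha hax => hxS ?_⟩
      exact List.mem_singleton.1 hax ▸ ((h.roots a).1 ha).1
    · have hpx : parOf N' x = none := parOf_eq hx'
      by_cases hax : a = x
      · simp [hax, hpx]
      · have : parOf N' a = parOf N a := parOf_congr (by simp [hN', hax])
        simpa [hax, this] using h.roots a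
    · obtain rfl : minOf N' m x = a := by simpa using ha
      cases hm : m with
      | none => simp [h.empty hm, minOf, LeastOn.singleton]
      | some b =>
        have hb := h.least b hm
        exact (hb.congr fun a ha => keyOf_congr (hold a ha)).union (.singleton N' x)
          (hF.live b (Finset.mem_union_left _ hb.1)) (by simp [hx'])
    · rw [Finset.card_union_of_disjoint (by simpa using hxS), Finset.card_singleton]
      exact congrArg (· + 1) h.size
  refine ⟨⟨_, hI⟩, ?_⟩
  rw [potential_eq hI.support, potential_eq h.support]
  have h1 := marks_union_le S {x} N'
  have h2 : marks S N' ≤ marks S N := marks_le_of_imp fun a ha => by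
    rw [mkOf_congr (hold a ha)]; exact id
  have h3 : marks {x} N' = 0 := by
    simp [marks, Finset.filter_singleton, mkOf_eq hx', hv]
  simp only [List.length_append, List.length_singleton, rate]
  omega

theorem amortized_union {S₁ S₂ : Finset ℕ} {H₁ H₂ : Heap K} (h₁ : Inv S₁ H₁) (h₂ : Inv S₂ H₂)
    (hs : Separate H₁ H₂) : Amortized (unionProg H₁ H₂) (unionStart H₁ H₂)
      (potential H₁ + potential H₂) 40 := by
  set N : ℕ → Option (Node K) := fun x => (H₁.nodes x).orElse fun _ => H₂.nodes x with hN
  have hN₁ : ∀ x ∈ S₁, N x = H₁.nodes x := fun x hx => by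
    obtain ⟨v, hv⟩ := Option.isSome_iff_exists.1 (h₁.forest.live x hx)
    simp [hN, hv]
  have hd : ∀ x ∈ S₂, H₁.nodes x = none := fun x hx => (hs x).resolve_right fun h => by
    simpa [h] using h₂.forest.live x hx
  have hdisj : Disjoint S₁ S₂ := Finset.disjoint_left.2 fun x hx hx' => by
    simpa [hd x hx'] using h₁.forest.live x hx
  have hN₂ : ∀ x ∈ S₂, N x = H₂.nodes x := fun x hx => by simp [hN, hd x hx]
  have hF := (h₁.forest.congr hN₁).union (h₂.forest.congr hN₂)
  have hl₁ : ∀ m, H₁.min = some m → LeastOn N S₁ m := fun m hm =>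
    (h₁.least m hm).congr fun x hx => keyOf_congr (hN₁ x hx)
  have hl₂ : ∀ m, H₂.min = some m → LeastOn N S₂ m := fun m hm =>
    (h₂.least m hm).congr fun x hx => keyOf_congr (hN₂ x hx)
  have fin : ∀ (m : Option ℕ) (A : List (Option ℕ)) (t : ℕ), t ≤ 10 →
      (∀ a, m = some a → LeastOn N (S₁ ∪ S₂) a) → (m = none → S₁ ∪ S₂ = ∅) →
      Ends (writeSize (H₁.n + H₂.n)) ⟨⟨N, H₁.roots ++ H₂.roots, m, 0⟩, A, t⟩ fun _ s' =>
        (∃ S, Inv S s'.heap) ∧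
          s'.time + rate * potential s'.heap ≤ rate * (potential H₁ + potential H₂) + 40 := by
    intro m A t ht hm hm'
    rw [ends_writeSize]
    have hI : Inv (S₁ ∪ S₂) ⟨N, H₁.roots ++ H₂.roots, m, H₁.n + H₂.n⟩ := by
      refine ⟨hF, fun x hx => ?_, ?_, fun x => ?_, hm, hm', ?_⟩
      · rw [Finset.mem_union, not_or] at hx
        simp [hN, h₁.support x hx.1, h₂.support x hx.2]
      · refine List.nodup_append'.2 ⟨h₁.nodup, h₂.nodup, fun x hx hx' => ?_⟩
        exact Finset.disjoint_left.1 hdisj ((h₁.roots x).1 hx).1 ((h₂.roots x).1 hx').1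
      · simp only [List.mem_append, h₁.roots, h₂.roots, Finset.mem_union, or_and_right]
        refine or_congr (and_congr_right fun hx => ?_) (and_congr_right fun hx => ?_)
        · rw [parOf_congr (hN₁ x hx)]
        · rw [parOf_congr (hN₂ x hx)]
      · rw [Finset.card_union_of_disjoint hdisj]
        exact congrArg₂ (· + ·) h₁.size h₂.size
    refine ⟨⟨_, hI⟩, ?_⟩
    rw [potential_eq hI.support, potential_eq h₁.support, potential_eq h₂.support]
    have e := marks_union_le S₁ S₂ N
    have e₁ : marks S₁ N ≤ marks S₁ H₁.nodes := marks_le_of_imp fun a ha => by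
      rw [mkOf_congr (hN₁ a ha)]; exact id
    have e₂ : marks S₂ N ≤ marks S₂ H₂.nodes := marks_le_of_imp fun a ha => by
      rw [mkOf_congr (hN₂ a ha)]; exact id
    simp only [List.length_append, rate]
    omega
  unfold Amortized unionProg
  change Ends _ ⟨⟨N, [], none, 0⟩, [], 0⟩ _
  rw [ends_bind, ends_tick, ends_bind, ends_iff rfl, ends_bind, ends_writeMin]
  cases hm₂ : H₂.min with
  | none =>
    refine fin _ _ _ (by dsimp only; omega) (fun a ha => ?_) (fun hm₁ => ?_)
    · simpa [h₂.empty hm₂] using hl₁ a ha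
    · simp [h₁.empty hm₁, h₂.empty hm₂]
  | some b =>
    dsimp only
    rw [ends_bind]
    have hb := hl₂ b hm₂
    have hbl := hF.live b (Finset.mem_union_right _ hb.1)
    refine ends_updateMin hbl (fun a ha => ?_) fun t ht => fin _ _ _ (by omega) (fun a ha => ?_)
      (by simp)
    · exact hF.live a (Finset.mem_union_left _ (hl₁ a ha).1)
    · obtain rfl : minOf N H₁.min b = a := by simpa using ha
      cases hm₁ : H₁.min with
      | none => simpa [h₁.empty hm₁, minOf] using hb
      | some a =>
        have ha := hl₁ a hm₁
        exact ha.union hb (hF.live a (Finset.mem_union_left _ ha.1)) hbl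

end Invariant

/-! ### Cascading cuts and DECREASE-KEY -/

section DecreaseKey

variable {K : Type} {S : Finset ℕ} {m : Option ℕ} {n : ℕ} {A : List (Option ℕ)}

/-- The root list after a cut. -/
theorem roots_severed {N : ℕ → Option (Node K)} {R : List ℕ} {x y : ℕ} (hnd : R.Nodup)
    (hR : ∀ a, a ∈ R ↔ a ∈ S ∧ parOf N a = none) (hx : x ∈ S) (hp : parOf N x = some y) :
    (R ++ [x]).Nodup ∧ ∀ a, a ∈ R ++ [x] ↔ a ∈ S ∧ parOf (severed N x y) a = none := by
  constructor
  · refine List.nodup_append'.2 ⟨hnd, List.nodup_singleton x, fun a ha hax => ?_⟩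
    have := ((hR a).1 ha).2
    rw [List.mem_singleton.1 hax, hp] at this
    simp at this
  · intro a
    rw [List.mem_append, List.mem_singleton, parOf_severed, hR]
    by_cases hax : a = x <;> simp [hax, hx]

variable [LinearOrder K]

/-- Every further cut uses up a mark, so induction on the number of marks gives termination. It also
gives the cost: one more root and one mark less release `rate` units, more than the six steps of a
round. The slack at `y` is the child that it has just lost. -/
theorem ends_cascadingCut (k : ℕ) :
    ∀ (N : ℕ → Option (Node K)) (R : List ℕ) (t y : ℕ), marks S N = k →
      Forest S N (some y) none → y ∈ S → R.Nodup → (∀ x, x ∈ R ↔ x ∈ S ∧ parOf N x = none) →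
      Ends (cascadingCut y) ⟨⟨N, R, m, n⟩, A, t⟩ fun _ s' =>
        ∃ N' R' t', s' = ⟨⟨N', R', m, n⟩, A, t'⟩ ∧ Forest S N' none none ∧
          (∀ x, keyOf N' x = keyOf N x) ∧ R'.Nodup ∧
          (∀ x, x ∈ R' ↔ x ∈ S ∧ parOf N' x = none) ∧
          t' + rate * (R'.length + 2 * marks S N') ≤
            t + rate * (R.length + 2 * marks S N) + 48 := by
  induction k using Nat.strong_induction_on with
  | _ k ih =>
  intro N R t y hk hF hy hnd hR
  obtain ⟨v, hv⟩ := Option.isSome_iff_exists.1 (hF.live y hy)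
  rw [cascadingCut, ends_bind, ends_readNode hv]
  cases hp : v.parent with
  | none =>
    dsimp only
    rw [ends_pure]
    refine ⟨N, R, _, rfl, hF.of_root fun a ha => ?_, fun _ => rfl, hnd, hR, by omega⟩
    obtain rfl : y = a := by simpa using ha
    exact (parOf_eq hv).trans hp
  | some z =>
    dsimp only
    have hpy : parOf N y = some z := (parOf_eq hv).trans hp
    by_cases hm : v.mark = false
    · have hv' : (⟨v.key, some z, v.children, v.degree, true⟩ : Node K) =
          { v with mark := true } := by rw [hp]
      rw [if_pos hm, ends_writeNode, hv']
      refine ⟨_, R, _, rfl, hF.marked hv hm, fun x => ?_, hnd, fun x => ?_, ?_⟩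
      · rw [keyOf_update]
        split_ifs with hxy
        · rw [hxy, keyOf_eq hv]
        · rfl
      · rw [hR, parOf_update]
        split_ifs with hxy
        · rw [hxy, parOf_eq hv]
        · rfl
      -- This case determines the constant `48`: two accesses plus `2 * rate` for the new mark.
      · have := marks_update_le (S := S) (N := N) (x := y) (v := { v with mark := true })
        simp only [rate]
        omega
    · have hmk : mkOf N y = true := by
        rw [mkOf_eq hv]; simpa using hm
      have hyz := hF.ne_parent hy hpy
      have hz := (hF.parent y hy z hpy).1
      have hms := marks_severed (y := z) hy hmk
      obtain ⟨hnd', hR'⟩ := roots_severed hnd hR hy hpy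
      rw [if_neg hm, ends_bind, ends_cut (hF.live y hy) (hF.live z hz) hyz]
      -- As a root `y` needs no slack any more; the debt moves on to `z`.
      refine (ih (marks S (severed N y z)) (by omega) _ _ _ z rfl
        (hF.severed hy hpy hyz (fun a ha => by simpa [eq_comm] using ha) (by simp)) hz hnd'
        hR').mono ?_
      rintro - s' ⟨N', R', t', rfl, h1, h2, h3, h4, h5⟩
      refine ⟨N', R', t', rfl, h1, fun x => (h2 x).trans (keyOf_severed x), h3, h4, ?_⟩
      simp only [List.length_append, List.length_singleton, rate] at h5 ⊢
      omega

theorem lt_update_left {N : ℕ → Option (Node K)} {x c : ℕ} {v : Node K} {k : K}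
    (hx : N x = some v) (hk : k ≤ v.key) (hc : c ≠ x) (h : lt N x c) :
    lt (Function.update N x (some { v with key := k })) x c := by
  obtain ⟨a, b, ha, hb, hab⟩ := h
  rw [keyOf_eq hx, Option.some.injEq] at ha
  subst ha
  refine ⟨k, b, by rw [keyOf_update, if_pos rfl], by rw [keyOf_update, if_neg hc, hb], ?_⟩
  rcases hab with hab | ⟨rfl, hab⟩
  · exact Or.inl (hk.trans_lt hab)
  · exact hk.lt_or_eq.imp id fun h => ⟨h, hab⟩

/-- Decreasing the key of `x`. -/
theorem Forest.decreased {N : ℕ → Option (Node K)} (h : Forest S N none none) {x : ℕ} {v : Node K}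
    {k : K} (hx : N x = some v) (hk : k ≤ v.key) :
    Forest S (Function.update N x (some { v with key := k })) none (some x) := by
  set N' := Function.update N x (some { v with key := k }) with hN'
  have hpar : parOf N' = parOf N := by
    funext a; rw [hN', parOf_update]; split_ifs with hax
    · rw [hax, parOf_eq hx]
    · rfl
  have hch : chOf N' = chOf N := by
    funext a; rw [hN', chOf_update]; split_ifs with hax
    · rw [hax, chOf_eq hx]
    · rfl
  have hdg : dgOf N' = dgOf N := by
    funext a; rw [hN', dgOf_update]; split_ifs with hax
    · rw [hax, dgOf_eq hx]
    · rfl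
  have hmk : mkOf N' = mkOf N := by
    funext a; rw [hN', mkOf_update]; split_ifs with hax
    · rw [hax, mkOf_eq hx]
    · rfl
  refine ⟨fun a ha => ?_, hch ▸ hdg ▸ h.deg, hch ▸ h.nodup, hch ▸ hpar ▸ h.child,
    hch ▸ hpar ▸ h.parent, fun c hc p hcp ho => ?_, hch ▸ hdg ▸ hmk ▸ h.index⟩
  · by_cases hax : a = x
    · simp [hN', hax]
    · simpa [hN', hax] using h.live a ha
  · have hcx : c ≠ x := fun hcx => ho (by rw [hcx])
    have hlt := h.order c hc p (hpar ▸ hcp) (by simp)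
    by_cases hpx : p = x
    · subst hpx
      exact lt_update_left hx hk hcx hlt
    · refine (lt_congr ?_ ?_).2 hlt <;> rw [hN', keyOf_update, if_neg (by assumption)]

theorem amortized_decreaseKey {H : Heap K} (h : Inv S H) {x : ℕ} {v : Node K} {k : K}
    (hx : H.nodes x = some v) (hk : k ≤ v.key) :
    Amortized (decreaseKey x k) H (potential H) 100 := by
  obtain ⟨N, R, m, n⟩ := H
  replace hx : N x = some v := hx
  have hxS : x ∈ S := by
    by_contra hxS
    simp [show N x = none from h.support x hxS] at hx
  obtain ⟨m, rfl⟩ : ∃ a, m = some a := by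
    cases m with
    | none => simp [h.empty rfl] at hxS
    | some a => exact ⟨a, rfl⟩
  have hm : LeastOn N S m := h.least m rfl
  set N₁ := Function.update N x (some { v with key := k }) with hN₁
  have hF₁ : Forest S N₁ none (some x) := h.forest.decreased hx hk
  have hkey : ∀ a, a ≠ x → keyOf N₁ a = keyOf N a := fun a ha => by
    rw [hN₁, keyOf_update, if_neg ha]
  have hpar : ∀ a, parOf N₁ a = parOf N a := fun a => by
    rw [hN₁, parOf_update]; split_ifs with hax
    · rw [hax, parOf_eq hx]
    · rfl
  have hmarks : marks S N₁ ≤ marks S N := marks_le_of_imp fun a _ => by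
    rw [hN₁, mkOf_update]; split_ifs with hax
    · rw [hax, mkOf_eq hx]; exact id
    · exact id
  have hR₁ : ∀ a, a ∈ R ↔ a ∈ S ∧ parOf N₁ a = none := fun a => by rw [hpar]; exact h.roots a
  -- All branches end by updating the minimum on a repaired forest whose keys are those of `N₁`.
  have fin : ∀ (N' : ℕ → Option (Node K)) (R' : List ℕ) (A : List (Option ℕ)) (t : ℕ),
      Forest S N' none none → (∀ a, keyOf N' a = keyOf N₁ a) → R'.Nodup →
      (∀ a, a ∈ R' ↔ a ∈ S ∧ parOf N' a = none) →
      t + rate * (R'.length + 2 * marks S N') ≤ rate * (R.length + 2 * marks S N) + 95 →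
      Ends (updateMin x) ⟨⟨N', R', some m, n⟩, A, t⟩ fun _ s' => (∃ S, Inv S s'.heap) ∧
        s'.time + rate * potential s'.heap ≤ rate * potential ⟨N, R, some m, n⟩ + 100 := by
    intro N' R' A t hF' hkey' hnd' hR' ht
    refine ends_updateMin (hF'.live x hxS) (fun a ha => ?_) fun t' ht' => ?_
    · obtain rfl : m = a := by simpa using ha
      exact hF'.live m hm.1
    have hI : Inv S ⟨N', R', some (minOf N' (some m) x), n⟩ := by
      refine ⟨hF', fun a ha => ?_, hnd', hR', fun a ha => ?_, by simp, h.size⟩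
      · have hax : a ≠ x := by rintro rfl; exact ha hxS
        have h1 : (keyOf N' a).isSome = (keyOf N a).isSome := by rw [hkey', hkey a hax]
        rw [keyOf_isSome, keyOf_isSome, show N a = none from h.support a ha] at h1
        simpa using h1
      · obtain rfl : minOf N' (some m) x = a := by simpa using ha
        suffices hl : LeastOn N₁ S (minOf N' (some m) x) from hl.congr fun a _ => hkey' a
        have hmin : minOf N' (some m) x = minOf N₁ (some m) x :=
          minOf_congr (hkey' m) (hkey' x)
        rw [hmin]
        by_cases hmx : m = x
        · subst hmx
          simp only [minOf, lt_irrefl, if_false]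
          exact ⟨hxS, fun w hw hne => lt_update_left hx hk hne (hm.2 w hw hne)⟩
        -- Only the key of `x` has changed, so the old minimum is still least among the other nodes
        -- and has to be compared with `x` alone.
        · have h1 : LeastOn N₁ (S.erase x) m :=
            ⟨Finset.mem_erase.2 ⟨hmx, hm.1⟩, fun w hw hne =>
              (lt_congr (hkey m hmx) (hkey w (Finset.ne_of_mem_erase hw))).2
                (hm.2 w (Finset.mem_of_mem_erase hw) hne)⟩
          have h2 := h1.union (.singleton N₁ x) (hF₁.live m hm.1) (hF₁.live x hxS)
          rwa [Finset.union_comm, ← Finset.insert_eq, Finset.insert_erase hxS] at h2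
    refine ⟨⟨S, hI⟩, ?_⟩
    rw [potential_eq hI.support, potential_eq h.support]
    dsimp only
    omega
  unfold Amortized decreaseKey
  rw [ends_bind, ends_readNode hx, ends_bind, ends_tick, if_neg hk.not_gt, ends_bind,
    ends_writeNode, ← hN₁]
  have hR := h.nodup
  cases hp : v.parent with
  | none =>
    have hpx : parOf N₁ x = none := by rw [hpar, parOf_eq hx, hp]
    refine fin N₁ R _ _ ⟨hF₁.live, hF₁.deg, hF₁.nodup, hF₁.child, hF₁.parent, fun c hc p hcp _ => ?_,
      hF₁.index⟩ (fun _ => rfl) hR hR₁ (by simp only [rate]; omega)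
    refine hF₁.order c hc p hcp fun hcx => ?_
    obtain rfl : x = c := by simpa using hcx
    simp [hpx] at hcp
  | some y =>
    have hpx : parOf N x = some y := by rw [parOf_eq hx, hp]
    have hpx₁ : parOf N₁ x = some y := by rw [hpar, hpx]
    have hxy := h.forest.ne_parent hxS hpx
    have hy := (h.forest.parent x hxS y hpx).1
    dsimp only
    rw [ends_bind]
    by_cases hlt : lt N₁ x y
    · rw [ends_less_of_lt (hF₁.live x hxS) (hF₁.live y hy) hlt, if_pos rfl, ends_bind,
        ends_cut (hF₁.live x hxS) (hF₁.live y hy) hxy, ends_bind]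
      obtain ⟨hnd', hR'⟩ := roots_severed hR hR₁ hxS hpx₁
      refine (ends_cascadingCut _ _ _ _ y rfl (hF₁.severed hxS hpx₁ hxy (by simp)
        (fun a ha => by simpa [eq_comm] using ha)) hy hnd' hR').mono ?_
      rintro - s' ⟨N', R', t', rfl, h1, h2, h3, h4, h5⟩
      refine fin N' R' _ t' h1 (fun a => (h2 a).trans (keyOf_severed a)) h3 h4 ?_
      have h6 : marks S (severed N₁ x y) ≤ marks S N₁ := marks_le_of_imp fun a _ => by
        rw [mkOf_severed]; split_ifs <;> simp
      simp only [List.length_append, List.length_singleton, rate] at h5 ⊢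
      omega
    · rw [ends_less_of_not_lt (hF₁.live x hxS) (hF₁.live y hy) hlt, if_neg (by simp)]
      refine fin N₁ R _ _ ⟨hF₁.live, hF₁.deg, hF₁.nodup, hF₁.child, hF₁.parent,
        fun c hc p hcp _ => ?_, hF₁.index⟩ (fun _ => rfl) hR hR₁ (by simp only [rate]; omega)
      by_cases hcx : c = x
      · subst hcx
        obtain rfl : y = p := by simpa [hpx₁] using hcp
        exact lt_of_not_lt (hF₁.live c hxS) (hF₁.live y hy) hxy hlt
      · exact hF₁.order c hc p hcp fun h => hcx (by simpa using h.symm)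

end DecreaseKey

/-! ### EXTRACT-MIN -/

section ExtractMin

variable {K : Type}

/-- The records after clearing the parent pointers of the nodes in `l`. -/
def detached (N : ℕ → Option (Node K)) (l : List ℕ) (a : ℕ) : Option (Node K) :=
  if a ∈ l then (N a).map fun v => { v with parent := none } else N a

theorem detached_isSome (N : ℕ → Option (Node K)) (l : List ℕ) (a : ℕ) :
    (detached N l a).isSome = (N a).isSome := by
  unfold detached; split_ifs <;> simp

theorem parOf_detached (N : ℕ → Option (Node K)) (l : List ℕ) (a : ℕ) :
    parOf (detached N l) a = if a ∈ l then none else parOf N a := by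
  unfold parOf detached; split_ifs <;> cases N a <;> simp

theorem chOf_detached (N : ℕ → Option (Node K)) (l : List ℕ) (a : ℕ) :
    chOf (detached N l) a = chOf N a := by
  unfold chOf detached; split_ifs <;> cases N a <;> simp

theorem dgOf_detached (N : ℕ → Option (Node K)) (l : List ℕ) (a : ℕ) :
    dgOf (detached N l) a = dgOf N a := by
  unfold dgOf detached; split_ifs <;> cases N a <;> simp

theorem mkOf_detached (N : ℕ → Option (Node K)) (l : List ℕ) (a : ℕ) :
    mkOf (detached N l) a = mkOf N a := by
  unfold mkOf detached; split_ifs <;> cases N a <;> simp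

theorem keyOf_detached (N : ℕ → Option (Node K)) (l : List ℕ) (a : ℕ) :
    keyOf (detached N l) a = keyOf N a := by
  unfold keyOf detached; split_ifs <;> cases N a <;> simp

theorem ends_forM_detach {m : Option ℕ} {n : ℕ} {A : List (Option ℕ)} (l : List ℕ) :
    ∀ (N : ℕ → Option (Node K)) (R : List ℕ) (t : ℕ) (Q : Unit → Machine K → Prop),
      (∀ x ∈ l, (N x).isSome) →
      Q () ⟨⟨detached N l, R ++ l, m, n⟩, A, t + 3 * l.length⟩ →
      Ends (l.forM fun x => do
        addRoot x
        let w ← readNode x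
        writeNode x { w with parent := none }) ⟨⟨N, R, m, n⟩, A, t⟩ Q := by
  induction l with
  | nil =>
    intro N R t Q _ hQ
    rw [List.forM_eq_forM, List.forM_nil, ends_pure]
    simpa [show detached N [] = N by funext a; simp [detached]] using hQ
  | cons x l ih =>
    intro N R t Q hl hQ
    obtain ⟨v, hv⟩ := Option.isSome_iff_exists.1 (hl x (by simp))
    rw [List.forM_eq_forM, List.forM_cons, ends_bind, ends_bind, ends_addRoot, ends_bind,
      ends_readNode hv, ends_writeNode]
    refine ih _ _ _ _ (fun a ha => ?_) ?_
    · by_cases hax : a = x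
      · simp [hax]
      · simpa [hax] using hl a (List.mem_cons_of_mem _ ha)
    · have h1 : detached (Function.update N x (some { v with parent := none })) l =
          detached N (x :: l) := by
        funext a
        by_cases hax : a = x
        · by_cases hal : a ∈ l <;> simp_all [detached]
        · simp [detached, hax]
      have h2 : t + 1 + 1 + 1 + 3 * l.length = t + 3 * (x :: l).length := by
        rw [List.length_cons]; omega
      rw [h1, h2]
      simpa using hQ

theorem succIn_cases {l : List ℕ} {z : ℕ} (hl : l.Nodup) (hz : z ∈ l) :
    (succIn l z = some z ∧ l.erase z = []) ∨ ∃ r, succIn l z = some r ∧ r ≠ z ∧ r ∈ l := by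
  obtain ⟨pre, post, rfl, hpre⟩ := List.eq_append_cons_of_mem hz
  have hdrop : (pre ++ z :: post).dropWhile (fun w => w != z) = z :: post := by
    rw [List.dropWhile_append_of_pos]
    · simp
    · intro a ha
      simp only [bne_iff_ne, ne_eq]
      rintro rfl
      exact hpre ha
  rw [succIn, hdrop, List.tail_cons]
  have hpost : z ∉ post := (List.nodup_cons.1 (List.nodup_append'.1 hl).2.1).1
  cases post with
  | cons p post =>
    refine Or.inr ⟨p, by simp, ?_, by simp⟩
    rintro rfl
    simp at hpost
  | nil =>
    cases pre with
    | nil => exact Or.inl (by simp)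
    | cons q pre =>
      refine Or.inr ⟨q, by simp, ?_, by simp⟩
      rintro rfl
      simp at hpre

variable [LinearOrder K] {S : Finset ℕ}

/-- Removing a root, whose children become roots. -/
theorem Forest.detached {N : ℕ → Option (Node K)} (h : Forest S N none none) {z : ℕ} (hz : z ∈ S)
    (hp : parOf N z = none) : Forest (S.erase z) (detached N (chOf N z)) none none := by
  have hch : ∀ a ∈ S, a ≠ z → ∀ c ∈ chOf N a, c ≠ z ∧ c ∉ chOf N z := fun a ha haz c hc => by
    have h1 := (h.child a ha c hc).2
    refine ⟨?_, fun hcz => haz ?_⟩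
    · rintro rfl; simp [hp] at h1
    · simpa [h1] using (h.child z hz c hcz).2
  refine ⟨fun a ha => ?_, fun a ha => ?_, fun a ha => ?_, fun a ha c hc => ?_, fun c hc p hcp => ?_,
    fun c hc p hcp _ => ?_, fun a ha i c hi => ?_⟩
  · rw [detached_isSome]; exact h.live a (Finset.mem_of_mem_erase ha)
  · rw [dgOf_detached, chOf_detached]; exact h.deg a (Finset.mem_of_mem_erase ha)
  · rw [chOf_detached]; exact h.nodup a (Finset.mem_of_mem_erase ha)
  · rw [chOf_detached] at hc
    obtain ⟨haz, ha⟩ := Finset.mem_erase.1 ha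
    obtain ⟨h1, h2⟩ := hch a ha haz c hc
    obtain ⟨h3, h4⟩ := h.child a ha c hc
    exact ⟨Finset.mem_erase.2 ⟨h1, h3⟩, by rw [parOf_detached, if_neg h2, h4]⟩
  · rw [parOf_detached] at hcp
    split_ifs at hcp with hcz
    obtain ⟨h1, h2⟩ := h.parent c (Finset.mem_of_mem_erase hc) p hcp
    refine ⟨Finset.mem_erase.2 ⟨?_, h1⟩, by rwa [chOf_detached]⟩
    rintro rfl
    exact hcz h2
  · rw [lt_congr (keyOf_detached _ _ _) (keyOf_detached _ _ _)]
    rw [parOf_detached] at hcp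
    split_ifs at hcp with hcz
    exact h.order c (Finset.mem_of_mem_erase hc) p hcp (by simp)
  · rw [chOf_detached] at hi
    rw [dgOf_detached, mkOf_detached]
    exact h.index a (Finset.mem_of_mem_erase ha) i c hi

/-- The `58` is the sum of `3` for detaching each of at most `D n` children, `23` for consolidating
it, `9` per cell of the array, and `23` for the potential of each new root. The old roots pay for
their own consolidation. -/
theorem amortized_extractMin {H : Heap K} (h : Inv S H) :
    Amortized extractMin H (potential H) (58 * D H.n + 60) := by
  obtain ⟨N, R, m, n⟩ := H
  unfold Amortized extractMin
  rw [ends_bind, ends_readMin]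
  cases m with
  | none =>
    dsimp only
    rw [ends_pure]
    exact ⟨⟨S, h⟩, by dsimp only; omega⟩
  | some z =>
    have hF : Forest S N none none := h.forest
    have hsize : n = S.card := h.size
    have hz : LeastOn N S z := h.least z rfl
    have hzp : parOf N z = none := hF.parOf_least hz
    have hR : ∀ x, x ∈ R ↔ x ∈ S ∧ parOf N x = none := h.roots
    obtain ⟨v, hv⟩ := Option.isSome_iff_exists.1 (hF.live z hz.1)
    dsimp only
    rw [ends_bind, ends_readNode hv, ends_bind, ← chOf_eq hv]
    set l := chOf N z with hl
    have hdeg : l.length ≤ D n := hF.deg z hz.1 ▸ hF.dgOf_le hsize.ge hz.1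
    refine ends_forM_detach l N R _ _ (fun x hx => hF.live x (hF.child z hz.1 x hx).1) ?_
    rw [ends_bind, ends_right, ends_bind, ends_removeRoot]
    set N₁ := detached N l with hN₁
    have hF₁ : Forest (S.erase z) N₁ none none := hF.detached hz.1 hzp
    have hzR : z ∈ R := (hR z).2 ⟨hz.1, hzp⟩
    have hnd : (R ++ l).Nodup := List.nodup_append'.2 ⟨h.nodup, hF.nodup z hz.1, fun x hx hxl => by
      simpa [(hF.child z hz.1 x hxl).2] using ((hR x).1 hx).2⟩
    have hR₁ : ∀ x, x ∈ (R ++ l).erase z ↔ x ∈ S.erase z ∧ parOf N₁ x = none := fun x => by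
      rw [hnd.mem_erase_iff, List.mem_append, hR, Finset.mem_erase, hN₁, parOf_detached, and_assoc]
      refine and_congr_right fun _ => ?_
      by_cases hxl : x ∈ l
      · simp [hxl, (hF.child z hz.1 x hxl).1]
      · simp [hxl]
    have hlen : ((R ++ l).erase z).length + 1 = R.length + l.length := by
      rw [List.length_erase_of_mem (List.mem_append_left _ hzR), List.length_append]
      have := List.length_pos_of_mem hzR
      omega
    have hmarks : marks (S.erase z) N₁ ≤ marks S N :=
      (marks_le_of_imp fun x _ => by rw [hN₁, mkOf_detached]; exact id).trans
        (marks_mono N (Finset.erase_subset _ _))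
    have fin : ∀ (N' : ℕ → Option (Node K)) (R' : List ℕ) (m' : Option ℕ) (A : List (Option ℕ))
        (t : ℕ), Forest (S.erase z) N' none none → Evolves N₁ N' → R'.Nodup →
        (∀ x, x ∈ R' ↔ x ∈ S.erase z ∧ parOf N' x = none) →
        (∀ a, m' = some a → LeastOn N' (S.erase z) a) → (m' = none → S.erase z = ∅) →
        t + rate * R'.length ≤ rate * R.length + 58 * D n + 57 →
        Ends (do
          let n ← readSize
          writeSize (n - 1)
          releaseNode z
          pure (some z)) ⟨⟨N', R', m', n⟩, A, t⟩ fun _ s' => (∃ S, Inv S s'.heap) ∧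
          s'.time + rate * potential s'.heap ≤
            rate * potential ⟨N, R, some z, n⟩ + (58 * D n + 60) := by
      intro N' R' m' A t hF' hE hnd' hR' hm hm' ht
      simp only [ends_bind, ends_readSize, ends_writeSize, ends_releaseNode, ends_pure]
      have hN' : ∀ x ∈ S.erase z, Function.update N' z none x = N' x := fun x hx =>
        Function.update_of_ne (Finset.ne_of_mem_erase hx) _ _
      have hI : Inv (S.erase z) ⟨Function.update N' z none, R', m', n - 1⟩ := by
        refine ⟨hF'.congr hN', fun x hx => ?_, hnd', fun x => ?_, fun a ha => ?_, hm', ?_⟩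
        · by_cases hxz : x = z
          · simp [hxz]
          · have hxS : x ∉ S := fun hxS => hx (Finset.mem_erase.2 ⟨hxz, hxS⟩)
            have h1 : (keyOf N' x).isSome = (N x).isSome := by
              rw [hE.key, hN₁, keyOf_detached, keyOf_isSome]
            rw [keyOf_isSome, show N x = none from h.support x hxS] at h1
            simpa [hxz] using h1
        · rw [hR']
          exact and_congr_right fun hx => by rw [parOf_congr (hN' x hx)]
        · exact (hm a ha).congr fun x hx => keyOf_congr (hN' x hx)
        · rw [Finset.card_erase_of_mem hz.1, ← hsize]
      refine ⟨⟨_, hI⟩, ?_⟩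
      rw [potential_eq hI.support, potential_eq h.support]
      have h1 : marks (S.erase z) (Function.update N' z none) ≤ marks (S.erase z) N₁ :=
        marks_le_of_imp fun x hx => by rw [mkOf_congr (hN' x hx)]; exact hE.mark x
      simp only [rate] at ht ⊢
      omega
    rcases succIn_cases hnd (List.mem_append_left l hzR) with ⟨hs, he⟩ | ⟨r, hs, hrz, hr⟩
    · rw [if_pos hs, ends_bind, ends_writeMin]
      -- A nonempty forest would have its least node as a root, but no root is left.
      have hemp : S.erase z = ∅ := by
        by_contra hne
        obtain ⟨μ, hμ⟩ := exists_leastOn (Finset.nonempty_iff_ne_empty.2 hne) hF₁.live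
        have := (hR₁ μ).2 ⟨hμ.1, hF₁.parOf_least hμ⟩
        simp [he] at this
      refine fin N₁ _ none _ _ hF₁ (.refl N₁) (hnd.erase z) hR₁ (by simp) (fun _ => hemp) ?_
      simp only [rate]
      omega
    · rw [hs, if_neg (by simpa using hrz), ends_bind, ends_writeMin, ends_bind]
      have hrS : r ∈ S.erase z := ((hR₁ r).1 (hnd.mem_erase_iff.2 ⟨hrz, hr⟩)).1
      refine (ends_consolidate hF₁ (hsize ▸ Finset.card_le_card (Finset.erase_subset z S))
        (hnd.erase z) hR₁ hrS).mono ?_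
      rintro - s' ⟨N', R', m', A', t', rfl, h1, h2, h3, h4, h5, h6, h7⟩
      refine fin N' R' (some m') A' t' h1 h2 h3 h4 (fun a ha => ?_) (by simp) ?_
      · obtain rfl : m' = a := by simpa using ha
        exact h5
      · simp only [rate]
        omega

end ExtractMin

/-! ### Sequences of operations -/

section Runs

variable {K α : Type}

theorem Ends.of_runs {p : Prog K α} {H H' : Heap K} {a : α} {t : ℕ} {Q : α → Machine K → Prop}
    (h : Ends p ⟨H, [], 0⟩ Q) (hr : Runs p H a H' t) : ∃ A, Q a ⟨H', A, t⟩ := by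
  obtain ⟨A, hA⟩ := hr
  exact ⟨A, (ends_iff hA).1 h⟩

variable [LinearOrder K]

theorem Amortized.exists_runs {p : Prog K α} {H : Heap K} {Φ B : ℕ} (h : Amortized p H Φ B) :
    ∃ a H' t, Runs p H a H' t ∧ (t : ℝ) + rate * ((potential H' : ℝ) - Φ) ≤ B := by
  obtain ⟨a, ⟨H', A, t⟩, hp, -, ht⟩ := h
  refine ⟨a, H', t, ⟨A, hp⟩, ?_⟩
  have : ((t + rate * potential H' : ℕ) : ℝ) ≤ ((rate * Φ + B : ℕ) : ℝ) := by exact_mod_cast ht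
  push_cast at this ⊢
  linarith

theorem Amortized.of_runs {p : Prog K α} {H H' : Heap K} {Φ B t : ℕ} {a : α}
    (h : Amortized p H Φ B) (hr : Runs p H a H' t) :
    (∃ S, Inv S H') ∧ (t : ℝ) + rate * (potential H' : ℝ) ≤ rate * (Φ : ℝ) + B := by
  obtain ⟨A, hI, ht⟩ := Ends.of_runs h hr
  exact ⟨hI, by exact_mod_cast ht⟩

/-- A history records only that DECREASE-KEY succeeded. Its preconditions are recovered from this: a
missing node makes the run stuck, and a larger key makes it fail. -/
theorem le_key_of_runs_decreaseKey {H H' : Heap K} {x t : ℕ} {k : K}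
    (h : Runs (decreaseKey x k) H () H' t) : ∃ v, H.nodes x = some v ∧ k ≤ v.key := by
  obtain ⟨N, R, m, n⟩ := H
  obtain ⟨A, hA⟩ := h
  have hE : Ends (decreaseKey x k) ⟨⟨N, R, m, n⟩, [], 0⟩ fun _ _ => True := (ends_iff hA).2 trivial
  unfold decreaseKey at hE
  rw [ends_bind] at hE
  cases hx : N x with
  | none =>
    obtain ⟨a, s', hs, -⟩ := hE
    simp only [readNode] at hs
    change ((N x).map fun v => _) = _ at hs
    simp [hx] at hs
  | some v =>
    refine ⟨v, hx, ?_⟩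
    rw [ends_readNode hx, ends_bind, ends_tick] at hE
    by_contra hk
    rw [if_pos (not_le.1 hk)] at hE
    obtain ⟨a, s', hs, -⟩ := hE
    cases hs

theorem one_le_lgBound (n : ℕ) : 1 ≤ lgBound n := le_max_left _ _

/-- `D n` is at most twice `lgBound n`, which is at least `1`, so `2 * 58 + 60 = 176` would do. -/
theorem extract_bound (n : ℕ) : ((58 * D n + 60 : ℕ) : ℝ) ≤ 200 * lgBound n := by
  have h1 := D_le n
  have h2 := one_le_lgBound n
  push_cast
  linarith

/-- The potential starts at zero and telescopes; for UNION the two histories and their potentials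
add up. The invariant is carried along because each amortized bound needs it, and by determinism
those bounds apply to the recorded runs. -/
theorem History.inv_and_le {H : Heap K} {t : ℕ} {b : ℝ} (h : History H t b) :
    (∃ S, Inv S H) ∧ (t : ℝ) + rate * (potential H : ℝ) ≤ 200 * b := by
  induction h with
  | makeHeap => exact ⟨⟨∅, inv_emptyHeap⟩, by rw [potential_emptyHeap]; norm_num⟩
  | insert x k _ hx hr ih =>
    obtain ⟨⟨S, hS⟩, ht⟩ := ih
    obtain ⟨hI, hc⟩ := (amortized_insert hS k hx).of_runs hr
    refine ⟨hI, ?_⟩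
    push_cast at hc ht ⊢
    linarith
  | findMin m _ hr ih =>
    obtain ⟨⟨S, hS⟩, ht⟩ := ih
    obtain ⟨hI, hc⟩ := (amortized_findMin hS).of_runs hr
    refine ⟨hI, ?_⟩
    push_cast at hc ht ⊢
    linarith
  | union _ _ hs hr ih₁ ih₂ =>
    obtain ⟨⟨S₁, hS₁⟩, ht₁⟩ := ih₁
    obtain ⟨⟨S₂, hS₂⟩, ht₂⟩ := ih₂
    obtain ⟨hI, hc⟩ := (amortized_union hS₁ hS₂ hs).of_runs hr
    refine ⟨hI, ?_⟩
    push_cast at hc ht₁ ht₂ ⊢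
    linarith
  | decreaseKey x k _ hr ih =>
    obtain ⟨⟨S, hS⟩, ht⟩ := ih
    obtain ⟨v, hv, hk⟩ := le_key_of_runs_decreaseKey hr
    obtain ⟨hI, hc⟩ := (amortized_decreaseKey hS hv hk).of_runs hr
    refine ⟨hI, ?_⟩
    push_cast at hc ht ⊢
    linarith
  | @extractMin H H' t τ b z _ hr ih =>
    obtain ⟨⟨S, hS⟩, ht⟩ := ih
    obtain ⟨hI, hc⟩ := (amortized_extractMin hS).of_runs hr
    refine ⟨hI, ?_⟩
    have := extract_bound H.n
    push_cast at hc ht this ⊢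
    linarith

theorem Reachable.exists_inv {H : Heap K} (h : Reachable H) : ∃ S, Inv S H := by
  obtain ⟨t, b, h⟩ := h
  exact h.inv_and_le.1

end Runs

end AdaptiveFib

open AdaptiveFib in
theorem mainTheorem1 :
    ∃ c C : ℝ, 0 < c ∧ 0 < C ∧ ∀ (K : Type) [LinearOrder K],
      -- EXTRACT-MIN
      (∀ H : Heap K, Reachable H → ∃ z H' t, Runs extractMin H z H' t ∧
        t + c * ((potential H' : ℝ) - potential H) ≤ C * lgBound H.n) ∧
      -- INSERT
      (∀ (H : Heap K) (x : ℕ) (k : K), Reachable H → H.nodes x = none →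
        ∃ H' t, Runs (AdaptiveFib.insert x k) H () H' t ∧
          t + c * ((potential H' : ℝ) - potential H) ≤ C) ∧
      -- FIND-MIN
      (∀ H : Heap K, Reachable H → ∃ m H' t, Runs findMin H m H' t ∧
        t + c * ((potential H' : ℝ) - potential H) ≤ C) ∧
      -- UNION
      (∀ H₁ H₂ : Heap K, Reachable H₁ → Reachable H₂ → Separate H₁ H₂ →
        ∃ H' t, Runs (unionProg H₁ H₂) (unionStart H₁ H₂) () H' t ∧
          t + c * ((potential H' : ℝ) - (potential H₁ + potential H₂)) ≤ C) ∧
      -- DECREASE-KEY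
      (∀ (H : Heap K) (x : ℕ) (v : Node K) (k : K), Reachable H → H.nodes x = some v →
        k ≤ v.key → ∃ H' t, Runs (decreaseKey x k) H () H' t ∧
          t + c * ((potential H' : ℝ) - potential H) ≤ C) ∧
      -- total time of every sequence of operations
      (∀ (H : Heap K) (t : ℕ) (b : ℝ), History H t b → (t : ℝ) ≤ C * b) := by
  refine ⟨rate, 200, by norm_num, by norm_num, fun K _ => ⟨fun H hH => ?_, fun H x k hH hx => ?_,
    fun H hH => ?_, fun H₁ H₂ hH₁ hH₂ hs => ?_, fun H x v k hH hx hk => ?_, fun H t b h => ?_⟩⟩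
  · obtain ⟨S, hS⟩ := hH.exists_inv
    obtain ⟨z, H', t, hr, ht⟩ := (amortized_extractMin hS).exists_runs
    exact ⟨z, H', t, hr, ht.trans (extract_bound H.n)⟩
  · obtain ⟨S, hS⟩ := hH.exists_inv
    obtain ⟨_, H', t, hr, ht⟩ := (amortized_insert hS k hx).exists_runs
    exact ⟨H', t, hr, ht.trans (by norm_num)⟩
  · obtain ⟨S, hS⟩ := hH.exists_inv
    obtain ⟨m, H', t, hr, ht⟩ := (amortized_findMin hS).exists_runs
    exact ⟨m, H', t, hr, ht.trans (by norm_num)⟩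
  · obtain ⟨S₁, hS₁⟩ := hH₁.exists_inv
    obtain ⟨S₂, hS₂⟩ := hH₂.exists_inv
    obtain ⟨_, H', t, hr, ht⟩ := (amortized_union hS₁ hS₂ hs).exists_runs
    rw [Nat.cast_add] at ht
    exact ⟨H', t, hr, ht.trans (by norm_num)⟩
  · obtain ⟨S, hS⟩ := hH.exists_inv
    obtain ⟨_, H', t, hr, ht⟩ := (amortized_decreaseKey hS hx hk).exists_runs
    exact ⟨H', t, hr, ht.trans (by norm_num)⟩
  · have h1 := h.inv_and_le.2
    -- The final potential is nonnegative and can be dropped.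
    have h2 : (0 : ℝ) ≤ (rate : ℕ) * (potential H : ℝ) := by positivity
    linarith
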